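/- Let $X$ and $Y$ be complex manifolds of dimension $n$ (for instance smooth projective varieties), with $Y$ connected. Let $\Delta=\sum_{i\in I}(1-\frac1{m_i})\Delta_i$ be an orbifold divisor on $X$, where $\sum_i\Delta_i$ is a simple normal crossing divisor with smooth $\Delta_i$, and $m_i=a_i/b_i\in[1,\infty]$ for integers $a_i\ge b_i\ge 0$, $a_i>0$ (with $a_i=1$ and $m_i=\infty$ if $b_i=0$). Let $|\Delta|=\bigcup_{m_i>1}\Delta_i$. Let $\pi\colon Y\to X$ be an adapted Galois covering: a finite (proper with finite fibres) surjective holomorphic map whose automorphism group acts transitively on the fibres, such that for each $i$ with $m_i>1$ one has $\pi^*\Delta_i=p_iD_i$ with $p_i$ a positive multiple of $a_i$ and $D_i$ a reduced simple normal crossing divisor, and such that $\mathrm{Supp}(\pi^*\Delta+\mathrm{Ram}(\pi))$ and the branch locus of $\pi$ have only normal crossings. Near $y\in Y$, choose coordinates $z_1,\dots,z_n$ of $X$ centred at $\pi(y)$ in which the $\Delta_i$ through $\pi(y)$ are coordinate hyperplanes. If $\{z_l=0\}$ is some $\Delta_i$ with $m_i>1$, put $m_l:=m_i$, $p_l:=p_i$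 and let $w_l$ be a local equation of $D_i$; otherwise put $m_l=p_l=w_l=1$. The sheaf $\Omega_{\pi,\Delta}$ of orbifold $1$-forms is locally generated over $\mathcal O_Y$ by the $w_l^{-p_l(1-1/m_l)}\pi^*dz_l$ for $1\le l\le n$. The sheaf $\bigoplus_N E_{k,N}\Omega_{\pi,\Delta}$ of orbifold jet differentials of order $k$ is the sheaf of $\mathcal O_Y$-algebras locally generated by the $w_l^{-p_l(1-j/m_l)^+}\pi^*d^{j}z_l$ for $1\le l\le n$ and $1\le j\le k$. Here $x^+=\max\{x,0\}$, and $d^jz_l$ is the jet coordinate on $J_kX$ given by the $j$-th Taylor coefficient of $z_l$ along a curve. Put $J_k(\pi,\Delta)=\mathrm{Spec}_Y\bigoplus_N E_{k,N}\Omega_{\pi,\Delta}$. Let $f\colon(\mathbb D,0)\to(X,x)$ be a germ of holomorphic curve that is not contained in $|\Delta|$. A lifting diagram $(\star)$ of $f$ consists of a connected Riemann surface $V$, a proper surjective holomorphic map $\rho\colon V\to\mathbb D$ and a holomorphic map $g\colon V\to Y$ with $\pi\circ g=f\circ\rho$. Its lifted $k$-jet $j_k^\star(g)\colon V\to\pi^*J_kX$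 sends $v$ to $g(v)$ together with the $k$-jet of $f$ at $\rho(v)$. One says that $j_k^\star(g)\in J_k(\pi,\Delta)$ if, for every open $U\subseteq Y$ and every orbifold jet differential $P$ of order $k$ on $U$, the meromorphic function $P(j_k^\star(g))$ is holomorphic on $g^{-1}(U)$. Let $t$ be the coordinate on $\mathbb D$. Then, for every sufficiently small disc $\mathbb D$ centred at $0$, the following are equivalent. 1. $f$ is an orbifold curve for $(X,\Delta)$: $f(\mathbb D)\not\subseteq|\Delta|$, and $\mathrm{mult}_t(f^*\Delta_i)\ge m_i$ for all $i$ and all $t\in\mathbb D$ with $f(t)\in\Delta_i$. 2. For any (equivalently, for one) lifting diagram $(\star)$, and for every orbifold form $\omega\in H^0(U,\Omega_{\pi,\Delta})$ on an open set $U\supseteq g(V)$, the meromorphic function $g^*\omega/\rho^*dt$ is holomorphic on $V$. 3. For any (equivalently, for one) lifting diagram $(\star)$ and for any (equivalently, for some) $k\ge1$, one has $j_k^\star(g)\in J_k(\pi,\Delta)$. -/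

import Mathlib

open Set Filter Topology
open scoped Manifold ContDiff ENNReal

noncomputable section

namespace OrbifoldCurve

/-! Complex manifolds of dimension `n` are manifolds modelled on `Fin n → ℂ` with analytic (`ω`)
transition maps, and a holomorphic map is a `ContMDiff` map of class `ω`. -/

section Crossings

variable (n : ℕ) {M : Type*} [TopologicalSpace M] [ChartedSpace (Fin n → ℂ) M]

/-- `φ` is a holomorphic coordinate chart of `M` centred at `x`. -/
def IsCentredChart (x : M) (φ : OpenPartialHomeomorph M (Fin n → ℂ)) : Prop :=
  φ ∈ IsManifold.maximalAtlas 𝓘(ℂ, Fin n → ℂ) ω M ∧ x ∈ φ.source ∧ φ x = 0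

/-- `h` is a reduced local equation at `x` of the normal crossing hypersurface `D`: in a
coordinate chart centred at `x`, `h` is a product of distinct coordinates, and `D` is its zero
locus. (If `x ∉ D` the product is empty.) Any two such equations differ by a unit near `x`. -/
def IsLocalEquation (D : Set M) (x : M) (h : M → ℂ) : Prop :=
  ∃ (φ : OpenPartialHomeomorph M (Fin n → ℂ)) (S : Finset (Fin n)),
    IsCentredChart n x φ ∧ ∀ z ∈ φ.source, h z = ∏ l ∈ S, φ z l ∧ (z ∈ D ↔ h z = 0)

/-- The reduced hypersurface with support `D` has only normal crossings. -/
def IsNormalCrossing (D : Set M) : Prop :=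
  ∀ x : M, ∃ h : M → ℂ, IsLocalEquation n D x h

/-- `φ` is a chart centred at `x` in which the hypersurfaces `E j` are distinct coordinate
hyperplanes: `ℓ l = some j` means that `E j` is `(φ_l = 0)`, and `ℓ l = none` means that the
coordinate `φ_l` is not involved; the `E j` not listed by `ℓ` do not meet the chart. -/
def IsSNCChart {J : Type*} (E : J → Set M) (x : M)
    (φ : OpenPartialHomeomorph M (Fin n → ℂ)) (ℓ : Fin n → Option J) : Prop :=
  IsCentredChart n x φ ∧
  (∀ z ∈ φ.source, ∀ j, z ∈ E j ↔ ∃ l, ℓ l = some j ∧ φ z l = 0) ∧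
  (∀ l l' j, ℓ l = some j → ℓ l' = some j → l = l')

/-- The `E j` are smooth hypersurfaces whose sum is a simple normal crossing divisor. -/
def IsSNC {J : Type*} (E : J → Set M) : Prop :=
  ∀ x : M, ∃ (φ : OpenPartialHomeomorph M (Fin n → ℂ)) (ℓ : Fin n → Option J),
    IsSNCChart n E x φ ℓ

end Crossings

/-- An orbifold divisor `∑ i, (1 - 1 / m i) Δ_i` with `m i = a i / b i ∈ [1, ∞]` and simple
normal crossing support `∑ i, Δ_i`. The integers `a i`, `b i` need not be coprime, and `a i = b i`
is allowed. -/
structure OrbifoldDivisor (n : ℕ) (X : Type*) [TopologicalSpace X] [ChartedSpace (Fin n → ℂ) X]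
    (I : Type*) where
  /-- the hypersurfaces `Δ_i` -/
  comp : I → Set X
  /-- numerators of the multiplicities -/
  a : I → ℕ
  /-- denominators of the multiplicities -/
  b : I → ℕ
  a_pos : ∀ i, 0 < a i
  b_le_a : ∀ i, b i ≤ a i
  a_eq_one : ∀ i, b i = 0 → a i = 1
  snc : IsSNC n comp

namespace OrbifoldDivisor

variable {n : ℕ} {X : Type*} [TopologicalSpace X] [ChartedSpace (Fin n → ℂ) X] {I : Type*}

/-- The orbifold multiplicity `m_i = a_i / b_i`, equal to `∞` if `b_i = 0`. -/
def m (Δ : OrbifoldDivisor n X I) (i : I) : ℝ≥0∞ := (Δ.a i : ℝ≥0∞) / (Δ.b i : ℝ≥0∞)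

/-- The support `|Δ|`, the union of the `Δ_i` with `m_i > 1`. -/
def support (Δ : OrbifoldDivisor n X I) : Set X := ⋃ i ∈ {i | Δ.b i < Δ.a i}, Δ.comp i

/-- The holomorphic curve `f : 𝔻_r → X` on the disc of radius `r` is an orbifold curve: it is
not contained in `|Δ|`, and whenever `f t ∈ Δ_i`, the vanishing order at `t` of `f^* Δ_i` is at
least `m_i`. -/
def IsOrbifoldCurve (Δ : OrbifoldDivisor n X I) (f : ℂ → X) (r : ℝ) : Prop :=
  (∃ t ∈ Metric.ball (0 : ℂ) r, f t ∉ Δ.support) ∧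
  ∀ t ∈ Metric.ball (0 : ℂ) r, ∀ i, f t ∈ Δ.comp i →
    ∀ h : X → ℂ, IsLocalEquation n (Δ.comp i) (f t) h →
      Δ.m i ≤ ((analyticOrderAt (fun s => h (f s)) t : ℕ∞) : ℝ≥0∞)

end OrbifoldDivisor

section Coverings

variable {n : ℕ} {X : Type*} [TopologicalSpace X] [ChartedSpace (Fin n → ℂ) X]
  {Y : Type*} [TopologicalSpace Y] [ChartedSpace (Fin n → ℂ) Y] {I : Type*}

/-- The ramification locus: the points where the differential of `π` is not invertible. -/
def Ram (n : ℕ) {X : Type*} [TopologicalSpace X] [ChartedSpace (Fin n → ℂ) X]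
    {Y : Type*} [TopologicalSpace Y] [ChartedSpace (Fin n → ℂ) Y] (π : Y → X) : Set Y :=
  {y | ¬ Function.Bijective (mfderiv 𝓘(ℂ, Fin n → ℂ) 𝓘(ℂ, Fin n → ℂ) π y)}

/-- A Galois covering: a finite (proper with finite fibres) surjective holomorphic map, the
automorphism group of which acts transitively on the fibres. -/
structure IsGaloisCovering (n : ℕ) {X : Type*} [TopologicalSpace X] [ChartedSpace (Fin n → ℂ) X]
    {Y : Type*} [TopologicalSpace Y] [ChartedSpace (Fin n → ℂ) Y] (π : Y → X) : Prop where
  holomorphic : ContMDiff 𝓘(ℂ, Fin n → ℂ) 𝓘(ℂ, Fin n → ℂ) ω π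
  surjective : Function.Surjective π
  proper : IsProperMap π
  finite_fibre : ∀ x, (π ⁻¹' {x}).Finite
  transitive : ∀ y y', π y = π y' →
    ∃ e : Diffeomorph 𝓘(ℂ, Fin n → ℂ) 𝓘(ℂ, Fin n → ℂ) Y Y ω, (∀ z, π (e z) = π z) ∧ e y = y'

/-- The Galois covering `π : Y → X` is adapted to `Δ`, with `π^* Δ_i = p_i D_i` for each
component `Δ_i` of `|Δ|`. Here `D_i` is reduced with support `π⁻¹(Δ_i)`. -/
structure IsAdaptedCovering (Δ : OrbifoldDivisor n X I) (π : Y → X) (p : I → ℕ) : Prop where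
  galois : IsGaloisCovering n π
  pos : ∀ i, Δ.b i < Δ.a i → 0 < p i
  dvd : ∀ i, Δ.b i < Δ.a i → Δ.a i ∣ p i
  snc : ∀ i, Δ.b i < Δ.a i →
    ∃ (J : Type) (E : J → Set Y), IsSNC n E ∧ π ⁻¹' (Δ.comp i) = ⋃ j, E j
  pullback : ∀ i, Δ.b i < Δ.a i → ∀ (y : Y) (h : X → ℂ) (w : Y → ℂ),
    IsLocalEquation n (Δ.comp i) (π y) h → IsLocalEquation n (π ⁻¹' (Δ.comp i)) y w →
    ∃ u : Y → ℂ, ContMDiffAt 𝓘(ℂ, Fin n → ℂ) 𝓘(ℂ) ω u y ∧ u y ≠ 0 ∧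
      ∀ᶠ y' in 𝓝 y, h (π y') = u y' * w y' ^ p i
  nc_ram : IsNormalCrossing n (π ⁻¹' Δ.support ∪ Ram n π)
  nc_branch : IsNormalCrossing n (π '' Ram n π)

/-- Local data at `y` generating the orbifold forms and the orbifold jet differentials: a chart
`z = φ` of `X` centred at `π y` in which the `Δ_i` are coordinate hyperplanes, and, for every
coordinate `z_l` with `(z_l = 0) = Δ_i` a component of `|Δ|`, a local equation `w_l` of `D_i`. -/
structure OrbifoldFrame (Δ : OrbifoldDivisor n X I) (π : Y → X) (y : Y) where
  φ : OpenPartialHomeomorph X (Fin n → ℂ)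
  ℓ : Fin n → Option I
  chart : IsSNCChart n Δ.comp (π y) φ ℓ
  w : Fin n → Y → ℂ
  equation : ∀ l i, ℓ l = some i → Δ.b i < Δ.a i → IsLocalEquation n (π ⁻¹' (Δ.comp i)) y (w l)

namespace OrbifoldFrame

variable {Δ : OrbifoldDivisor n X I} {π : Y → X} {y : Y}

/-- The pole order `p_i (1 - j / m_i)⁺` if `(z_l = 0) = Δ_i`, and `0` if `z_l` is not involved in
`Δ`. The subtraction of natural numbers is the positive part, and the division is exact because
`a_i ∣ p_i` or `a_i = b_i`. -/
def poleOrder (F : OrbifoldFrame Δ π y) (p : I → ℕ) (l : Fin n) (j : ℕ) : ℕ :=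
  match F.ℓ l with
  | none => 0
  | some i => p i - (j * p i * Δ.b i) / Δ.a i

/-- The `1`-form `w_l ^ (-p_l (1 - 1 / m_l)) π^* (d z_l)` at `y'`. -/
def formGen (F : OrbifoldFrame Δ π y) (p : I → ℕ) (l : Fin n) (y' : Y) :
    TangentSpace 𝓘(ℂ, Fin n → ℂ) y' →L[ℂ] ℂ :=
  ((F.w l y' ^ F.poleOrder p l 1)⁻¹ : ℂ) •
    (mfderiv 𝓘(ℂ, Fin n → ℂ) 𝓘(ℂ) (fun z => F.φ (π z) l) y' :
      TangentSpace 𝓘(ℂ, Fin n → ℂ) y' →L[ℂ] ℂ)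

/-- The function `w_l ^ (-p_l (1 - j / m_l)⁺) π^* (d^j z_l)` at `y'` on the jets of curves `γ` in
`X` with `γ 0 = π y'`; the jet coordinate `d^j z_l` is the `j`-th Taylor coefficient. -/
def jetGen (F : OrbifoldFrame Δ π y) (p : I → ℕ) (l : Fin n) (j : ℕ) (y' : Y) (γ : ℂ → X) : ℂ :=
  (F.w l y' ^ F.poleOrder p l j)⁻¹ *
    ((j.factorial : ℂ)⁻¹ * iteratedDeriv j (fun s => F.φ (γ s) l) 0)

end OrbifoldFrame

/-- `η ∈ H⁰(U, Ω_{π,Δ})`: near every point of `U`, and off the poles `π⁻¹|Δ|`, `η` is a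
combination of the generators with holomorphic coefficients. -/
def IsOrbifoldForm (Δ : OrbifoldDivisor n X I) (π : Y → X) (p : I → ℕ) (U : Set Y)
    (η : (y : Y) → TangentSpace 𝓘(ℂ, Fin n → ℂ) y →L[ℂ] ℂ) : Prop :=
  ∀ y ∈ U, ∃ (F : OrbifoldFrame Δ π y) (c : Fin n → Y → ℂ),
    (∀ l, ContMDiffAt 𝓘(ℂ, Fin n → ℂ) 𝓘(ℂ) ω (c l) y) ∧
    ∀ᶠ y' in 𝓝 y, π y' ∉ Δ.support → η y' = ∑ l, c l y' • F.formGen p l y'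

/-- `P` is a section over `U` of the sheaf of algebras `⨁ N, E_{k,N} Ω_{π,Δ}` of orbifold jet
differentials of order `k`: near every point of `U`, and off the poles `π⁻¹|Δ|`, `P` is a
polynomial in the generators of order `1, …, k` with holomorphic coefficients. Here `P y γ` is the
value of `P` at the point of `π^* J_k X` given by `y` and the `k`-jet at `0` of a holomorphic
curve `γ` with `γ 0 = π y`. -/
def IsOrbifoldJetDifferential (Δ : OrbifoldDivisor n X I) (π : Y → X) (p : I → ℕ) (k : ℕ)
    (U : Set Y) (P : Y → (ℂ → X) → ℂ) : Prop :=
  ∀ y ∈ U, ∃ (F : OrbifoldFrame Δ π y) (s : Finset (Fin n × Fin k → ℕ))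
    (c : (Fin n × Fin k → ℕ) → Y → ℂ),
    (∀ α ∈ s, ContMDiffAt 𝓘(ℂ, Fin n → ℂ) 𝓘(ℂ) ω (c α) y) ∧
    ∀ᶠ y' in 𝓝 y, π y' ∉ Δ.support → ∀ γ : ℂ → X,
      ContMDiffAt 𝓘(ℂ) 𝓘(ℂ, Fin n → ℂ) ω γ 0 → γ 0 = π y' →
      P y' γ = ∑ α ∈ s, c α y' *
        ∏ q : Fin n × Fin k, F.jetGen p q.1 (q.2.val + 1) y' γ ^ α q

/-- A lifting diagram of `f : 𝔻_r → X` through `π`: a Riemann surface `V` (connected and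
Hausdorff), a proper surjective holomorphic map `ρ : V → 𝔻_r`, and a holomorphic map `g : V → Y`
with `π ∘ g = f ∘ ρ`. -/
structure LiftingDiagram (n : ℕ) {X Y : Type*} [TopologicalSpace Y]
    [ChartedSpace (Fin n → ℂ) Y] (π : Y → X) (f : ℂ → X) (r : ℝ) where
  V : Type
  [topologicalSpace : TopologicalSpace V]
  [chartedSpace : ChartedSpace ℂ V]
  [isManifold : IsManifold 𝓘(ℂ) ω V]
  [t2Space : T2Space V]
  [connectedSpace : ConnectedSpace V]
  ρ : V → Metric.ball (0 : ℂ) r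
  ρ_holomorphic : ContMDiff 𝓘(ℂ) 𝓘(ℂ) ω (fun v => (ρ v : ℂ))
  ρ_proper : IsProperMap ρ
  ρ_surjective : Function.Surjective ρ
  g : V → Y
  g_holomorphic : ContMDiff 𝓘(ℂ) 𝓘(ℂ, Fin n → ℂ) ω g
  comm : ∀ v, π (g v) = f (ρ v)

attribute [instance] LiftingDiagram.topologicalSpace LiftingDiagram.chartedSpace
  LiftingDiagram.isManifold LiftingDiagram.t2Space LiftingDiagram.connectedSpace

namespace LiftingDiagram

variable {π : Y → X} {f : ℂ → X} {r : ℝ}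

/-- The pulled back form `ρ^* dt = d ρ` on `V`. -/
def dt (𝒟 : LiftingDiagram n π f r) (v : 𝒟.V) : TangentSpace 𝓘(ℂ) v →L[ℂ] ℂ :=
  mfderiv 𝓘(ℂ) 𝓘(ℂ) (fun v' => (𝒟.ρ v' : ℂ)) v

/-- For every orbifold form `η` on an open `U ⊇ g(V)`, the meromorphic function `g^* η / ρ^* dt`
is holomorphic: `g^* η = Φ · ρ^* dt` off the preimage of `|Δ|` for some holomorphic function `Φ`
on `V`. -/
def FormsHolomorphic (𝒟 : LiftingDiagram n π f r) (Δ : OrbifoldDivisor n X I) (p : I → ℕ) : Prop :=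
  ∀ (U : Set Y) (η : (y : Y) → TangentSpace 𝓘(ℂ, Fin n → ℂ) y →L[ℂ] ℂ),
    IsOpen U → range 𝒟.g ⊆ U → IsOrbifoldForm Δ π p U η →
    ∃ Φ : 𝒟.V → ℂ, ContMDiff 𝓘(ℂ) 𝓘(ℂ) ω Φ ∧
      ∀ v, π (𝒟.g v) ∉ Δ.support → ∀ ξ : TangentSpace 𝓘(ℂ) v,
        η (𝒟.g v) (mfderiv 𝓘(ℂ) 𝓘(ℂ, Fin n → ℂ) 𝒟.g v ξ) =
          Φ v * 𝒟.dt v ξ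

/-- The lifted jet `j_k^⋆(g) = (g, f' ∘ ρ, …, f^(k) ∘ ρ)` with values in `π^* J_k X`, in the form
of a point of `Y` and a curve in `X` that represents the `k`-jet: that of `f` at `ρ v`. -/
def liftedJet (𝒟 : LiftingDiagram n π f r) (v : 𝒟.V) : Y × (ℂ → X) :=
  (𝒟.g v, fun s => f ((𝒟.ρ v : ℂ) + s))

/-- `j_k^⋆(g) ∈ J_k(π,Δ)`: the lifted jet is a point with values in `V` of the relative spectrum
`J_k(π,Δ) = Spec ⨁ N, E_{k,N} Ω_{π,Δ}` over `Y`, that is, evaluating any local section of the sheaf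
of orbifold jet differentials of order `k` at `j_k^⋆(g)` gives a holomorphic function. -/
def JetInOrbifoldJetSpace (𝒟 : LiftingDiagram n π f r) (Δ : OrbifoldDivisor n X I) (p : I → ℕ)
    (k : ℕ) : Prop :=
  ∀ (U : Set Y) (P : Y → (ℂ → X) → ℂ), IsOpen U → IsOrbifoldJetDifferential Δ π p k U P →
    ∃ Φ : 𝒟.V → ℂ, ContMDiffOn 𝓘(ℂ) 𝓘(ℂ) ω Φ (𝒟.g ⁻¹' U) ∧
      ∀ v ∈ 𝒟.g ⁻¹' U, π (𝒟.g v) ∉ Δ.support →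
        P (𝒟.liftedJet v).1 (𝒟.liftedJet v).2 = Φ v

end LiftingDiagram

end Coverings

end OrbifoldCurve

end

noncomputable section

/-! The equivalence is a count of vanishing orders at one point `v` of a lift. Let `e` be the order
of `ρ - ρ v`, let `μ` be the order at `ρ v` of the coordinate of `f` that cuts out `Δ_i` (here `m_i
= a/b > 1`), and let `o` be the order of `w ∘ g`. Since `z_l ∘ π` is a unit times `w ^ p`, one has
`μ e = p o`. For `j ≤ μ` and `j < m_i`, the generator of order `j` therefore has order `e (μ - j) -
(1 - j / m_i) p o = e j (μ / m_i - 1)` along the lifted jet. This is nonnegative exactly when `μ ≥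
m_i`, whatever the lift and whatever `j ≥ 1`. If `j ≥ m_i` the generator has no pole. Hence the
multiplicity condition makes every generator holomorphic (`exists_analyticAt_jet_quotient`), and the
generators of order one on a single lift already give it back (`le_order_mul_of_deriv_eq`). Forms
and jets of order one agree because `g^*` of a generating form is the corresponding jet generator
times `ρ^* dt`.

Two global points remain. To test a lift on generators, they must be sections over a neighbourhood
of all of `g(V)`. On a small disc the connected set `g(V)` stays near one point of the finite fibre
over `f 0`, and the generators of a frame at that point are sections near it
(`exists_frame_range_subset`, `exists_isOpen_sections`).

To pass from "all lifts" to "some lift", a lift must exist (`exists_ramified_lift`). The curve may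
lie inside the branch locus, where covering theory says nothing. So it is perturbed off the branch
locus away from the origin, the perturbed curves are lifted through `exp`, finiteness of the fibres
gives a common period `2πiN`, and a Montel limit of the lifts in `s = t^{1/N}` extends over the
origin. -/

namespace OrbifoldCurve

/-! ### Limits of bounded holomorphic maps, and descent through the logarithm. -/

/-- **Montel's theorem** along an ultrafilter: a uniformly bounded family of holomorphic maps
converges pointwise to a holomorphic map. -/
theorem exists_differentiableOn_tendsto_ultrafilter {ι E : Type*} [NormedAddCommGroup E]
    [NormedSpace ℂ E] [ProperSpace E] {U : Set ℂ} (hU : IsOpen U) {F : ι → ℂ → E}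
    (hF : ∀ i, DifferentiableOn ℂ (F i) U) {c : E} {R : ℝ}
    (hR : ∀ i, ∀ z ∈ U, F i z ∈ Metric.closedBall c R) (𝒰 : Ultrafilter ι) :
    ∃ G : ℂ → E, DifferentiableOn ℂ G U ∧
      ∀ z ∈ U, G z ∈ Metric.closedBall c R ∧ Tendsto (fun i => F i z) 𝒰 (𝓝 (G z)) := by
  have key : ∀ z, ∃ y, z ∈ U → y ∈ Metric.closedBall c R ∧ Tendsto (fun i => F i z) 𝒰 (𝓝 y) := by
    intro z
    by_cases hz : z ∈ U
    · obtain ⟨y, hy, hle⟩ := (isCompact_closedBall c R).ultrafilter_le_nhds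
        (𝒰.map fun i => F i z)
        (le_principal_iff.2 (mem_map.2 (univ_mem' fun i => hR i z hz)))
      exact ⟨y, fun _ => ⟨hy, hle⟩⟩
    · exact ⟨0, fun h => absurd h hz⟩
  choose G hG using key
  refine ⟨G, ?_, hG⟩
  refine TendstoLocallyUniformlyOn.differentiableOn (F := F) (φ := (𝒰 : Filter ι)) ?_
    (Eventually.of_forall hF) hU
  rw [Metric.tendstoLocallyUniformlyOn_iff]
  intro ε hε x hx
  obtain ⟨δ, hδ, hball⟩ := Metric.isOpen_iff.1 hU x hx
  have hR0 : 0 ≤ R := dist_nonneg.trans (hG x hx).1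
  -- Values of each map lie within `2 R` of one another, so the Schwarz lemma bounds the oscillation
  -- about `x` uniformly in `i`, and pointwise convergence becomes locally uniform. The added `1`
  -- keeps `K` positive when `R = 0`.
  set K := (2 * R + 1) / δ with hK
  have hK0 : 0 < K := by positivity
  have hlip : ∀ i, ∀ y ∈ Metric.ball x δ, dist (F i y) (F i x) ≤ K * dist y x := by
    intro i y hy
    refine Complex.dist_le_div_mul_dist_of_mapsTo_ball ((hF i).mono hball) ?_ hy
    intro z hz
    have h1 := hR i z (hball hz)
    have h2 := hR i x hx
    rw [Metric.mem_closedBall] at h1 h2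
    have := dist_triangle_right (F i z) (F i x) c
    rw [Metric.mem_closedBall]
    linarith
  have hlipG : ∀ y ∈ Metric.ball x δ, dist (G y) (G x) ≤ K * dist y x := fun y hy =>
    le_of_tendsto ((hG y (hball hy)).2.dist (hG x hx).2)
      (Eventually.of_forall fun i => hlip i y hy)
  refine ⟨Metric.ball x (min δ (ε / (4 * K))),
    mem_nhdsWithin_of_mem_nhds (Metric.ball_mem_nhds _ (by positivity)), ?_⟩
  filter_upwards [Metric.tendsto_nhds.1 (hG x hx).2 (ε / 4) (by positivity)] with i hi y hy
  have hy1 : y ∈ Metric.ball x δ := Metric.ball_subset_ball (min_le_left _ _) hy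
  have hy2 : K * dist y x ≤ ε / 4 := by
    have : dist y x < ε / (4 * K) := (Metric.mem_ball.1 hy).trans_le (min_le_right _ _)
    rw [lt_div_iff₀ (by positivity)] at this
    linarith
  have h1 := hlipG y hy1
  have h2 := hlip i y hy1
  have h3 := dist_triangle4 (G y) (G x) (F i x) (F i y)
  rw [dist_comm] at hi
  rw [dist_comm (F i x)] at h3
  linarith

/-- A holomorphic function of `log s` with period `2 π i` is holomorphic in `s ≠ 0`. -/
theorem differentiableOn_comp_log_of_periodic {E : Type*} [NormedAddCommGroup E] [NormedSpace ℂ E]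
    {h : ℂ → E} {σ : ℝ} (hd : ∀ β : ℂ, ‖Complex.exp β‖ < σ → DifferentiableAt ℂ h β)
    (hper : ∀ β : ℂ, ‖Complex.exp β‖ < σ → h (β + 2 * Real.pi * Complex.I) = h β) :
    DifferentiableOn ℂ (fun s => h (Complex.log s)) (Metric.ball 0 σ \ {0}) := by
  have hexp : ∀ (k : ℕ) (β : ℂ), Complex.exp (β + k * (2 * Real.pi * Complex.I)) = Complex.exp β :=
    fun k β => by simpa using Complex.exp_periodic.nat_mul k β
  have hnat : ∀ (k : ℕ) (β : ℂ), ‖Complex.exp β‖ < σ →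
      h (β + k * (2 * Real.pi * Complex.I)) = h β := by
    intro k
    induction k with
    | zero => intro β _; simp
    | succ k ih =>
      intro β hβ
      have := hper (β + k * (2 * Real.pi * Complex.I)) (by rwa [hexp])
      rw [← ih β hβ, ← this]
      push_cast; ring_nf
  have heq : ∀ β β' : ℂ, Complex.exp β = Complex.exp β' → ‖Complex.exp β‖ < σ → h β = h β' := by
    intro β β' he hβ
    obtain ⟨k, hk⟩ := Complex.exp_eq_exp_iff_exists_int.1 he
    obtain ⟨m, rfl | rfl⟩ := k.eq_nat_or_neg
    · rw [hk]; exact hnat m β' (he ▸ hβ)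
    · have : β' = β + m * (2 * Real.pi * Complex.I) := by rw [hk]; push_cast; ring
      rw [this]; exact (hnat m β hβ).symm
  rintro s ⟨hs, hs0⟩
  have hs0 : s ≠ 0 := hs0
  have hsσ : ‖s‖ < σ := by simpa using hs
  refine DifferentiableAt.differentiableWithinAt ?_
  -- Near `s` the principal logarithm is replaced by the branch `log (z / s) + log s`, which has no
  -- cut there; periodicity of `h` absorbs the difference.
  have hloc : (fun z => h (Complex.log z)) =ᶠ[𝓝 s]
      fun z => h (Complex.log (z / s) + Complex.log s) := by
    have h0 : ∀ᶠ z in 𝓝 s, z ≠ 0 := isOpen_ne.mem_nhds hs0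
    have h1 : ∀ᶠ z in 𝓝 s, ‖z‖ < σ := (isOpen_lt continuous_norm continuous_const).mem_nhds hsσ
    filter_upwards [h0, h1] with z hz hzσ
    apply heq
    · rw [Complex.exp_add, Complex.exp_log hz, Complex.exp_log hs0,
        Complex.exp_log (div_ne_zero hz hs0), div_mul_cancel₀ _ hs0]
    · rwa [Complex.exp_log hz]
  refine DifferentiableAt.congr_of_eventuallyEq ?_ hloc
  have hlog : DifferentiableAt ℂ (fun z => Complex.log (z / s) + Complex.log s) s := by
    refine DifferentiableAt.add_const _ (DifferentiableAt.clog (by fun_prop) ?_)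
    rw [div_self hs0]; exact Complex.one_mem_slitPlane
  refine DifferentiableAt.comp (g := h) s ?_ hlog
  apply hd
  rw [div_self hs0, Complex.log_one, zero_add, Complex.exp_log hs0]
  exact hsσ

/-! ### Galois coverings off the branch locus. -/

section LocalInverse

variable {n : ℕ} {X : Type*} [TopologicalSpace X] [ChartedSpace (Fin n → ℂ) X]
  [IsManifold 𝓘(ℂ, Fin n → ℂ) ω X]
  {Y : Type*} [TopologicalSpace Y] [ChartedSpace (Fin n → ℂ) Y] [IsManifold 𝓘(ℂ, Fin n → ℂ) ω Y]

/-- The holomorphic inverse function theorem for maps of complex manifolds. -/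
theorem exists_openPartialHomeomorph_of_notMem_ram {π : Y → X}
    (hπ : ContMDiff 𝓘(ℂ, Fin n → ℂ) 𝓘(ℂ, Fin n → ℂ) ω π) {y : Y} (hy : y ∉ Ram n π) :
    ∃ e : OpenPartialHomeomorph Y X, y ∈ e.source ∧ EqOn π e e.source ∧
      ContMDiffAt 𝓘(ℂ, Fin n → ℂ) 𝓘(ℂ, Fin n → ℂ) ω e.symm (π y) := by
  set α := chartAt (Fin n → ℂ) y with hα
  set β := chartAt (Fin n → ℂ) (π y) with hβ
  set P : (Fin n → ℂ) → (Fin n → ℂ) := fun u => β (π (α.symm u)) with hP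
  have hyα : y ∈ α.source := mem_chart_source _ y
  have hyβ : π y ∈ β.source := mem_chart_source _ (π y)
  have hPc : ContDiffAt ℂ ω P (α y) := by
    have := (contMDiffAt_iff_of_mem_maximalAtlas (I := 𝓘(ℂ, Fin n → ℂ)) (I' := 𝓘(ℂ, Fin n → ℂ))
      (IsManifold.chart_mem_maximalAtlas y) (IsManifold.chart_mem_maximalAtlas (π y)) hyα hyβ).1
      (hπ y)
    have h2 := this.2
    rw [modelWithCornersSelf_coe, range_id, contDiffWithinAt_univ] at h2
    exact h2
  have hmd : MDifferentiableAt 𝓘(ℂ, Fin n → ℂ) 𝓘(ℂ, Fin n → ℂ) π y :=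
    (hπ y).mdifferentiableAt (by simp)
  have hder : mfderiv 𝓘(ℂ, Fin n → ℂ) 𝓘(ℂ, Fin n → ℂ) π y = fderiv ℂ P (α y) := by
    have h : fderivWithin ℂ (writtenInExtChartAt 𝓘(ℂ, Fin n → ℂ) 𝓘(ℂ, Fin n → ℂ) y π)
        (range 𝓘(ℂ, Fin n → ℂ)) (extChartAt 𝓘(ℂ, Fin n → ℂ) y y) = fderiv ℂ P (α y) := by
      rw [modelWithCornersSelf_coe, range_id, fderivWithin_univ]
      rfl
    exact hmd.mfderiv.trans h
  have hbij : Function.Bijective (fderiv ℂ P (α y)) := by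
    have h := not_not.1 hy
    rw [hder] at h
    exact h
  let A : (Fin n → ℂ) ≃L[ℂ] (Fin n → ℂ) :=
    ContinuousLinearEquiv.ofBijective (fderiv ℂ P (α y))
      (LinearMap.ker_eq_bot.2 hbij.1) (LinearMap.range_eq_top.2 hbij.2)
  have hA : HasFDerivAt P (A : (Fin n → ℂ) →L[ℂ] (Fin n → ℂ)) (α y) := by
    rw [ContinuousLinearEquiv.coe_ofBijective]
    exact (hPc.differentiableAt (by simp)).hasFDerivAt
  have hω : (ω : ℕ∞ω) ≠ 0 := by simp
  set Q := hPc.toOpenPartialHomeomorph P hA hω with hQ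
  have hQP : ∀ u, Q u = P u := fun u => rfl
  have hmemQ : α y ∈ Q.source := hPc.mem_toOpenPartialHomeomorph_source hA hω
  -- Only over the domain of `β` does `β.symm ∘ P ∘ α` give back `π`.
  have hopen : IsOpen (π ⁻¹' β.source) := β.open_source.preimage hπ.continuous
  set e := ((α.trans Q).trans β.symm).restrOpen (π ⁻¹' β.source) hopen with he
  have hPy : P (α y) = β (π y) := by simp [hP, α.left_inv hyα]
  refine ⟨e, ?_, ?_, ?_⟩
  · simp [he, hyα, hmemQ, hyβ, hQP, hPy, β.map_source hyβ]
  · intro z hz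
    simp only [he, OpenPartialHomeomorph.restrOpen_source, OpenPartialHomeomorph.trans_source,
      mem_inter_iff, mem_preimage] at hz
    have h1 : z ∈ α.source := hz.1.1.1
    change π z = β.symm (Q (α z))
    rw [hQP, hP]
    simp only
    rw [α.left_inv h1, β.left_inv hz.2]
  · have hesymm : (e.symm : X → Y) = fun x => α.symm (Q.symm (β x)) := rfl
    rw [hesymm]
    have h1 : ContMDiffAt 𝓘(ℂ, Fin n → ℂ) 𝓘(ℂ, Fin n → ℂ) ω β (π y) :=
      contMDiffAt_of_mem_maximalAtlas (IsManifold.chart_mem_maximalAtlas (π y)) hyβ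
    have h2 : ContMDiffAt 𝓘(ℂ, Fin n → ℂ) 𝓘(ℂ, Fin n → ℂ) ω Q.symm (β (π y)) := by
      rw [← hPy]
      exact (hPc.to_localInverse hA hω).contMDiffAt
    have hQα : Q.symm (β (π y)) = α y := by
      rw [← hPy, ← hQP, Q.left_inv hmemQ]
    have h3 : ContMDiffAt 𝓘(ℂ, Fin n → ℂ) 𝓘(ℂ, Fin n → ℂ) ω α.symm (Q.symm (β (π y))) := by
      rw [hQα]
      exact contMDiffAt_symm_of_mem_maximalAtlas (IsManifold.chart_mem_maximalAtlas y)
        (α.map_source hyα)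
    exact h3.comp (π y) (h2.comp (π y) h1)

/-- A Galois covering is a topological covering over the complement of its branch locus. -/
theorem IsGaloisCovering.isCoveringMapOn [T2Space Y] {π : Y → X} (hπ : IsGaloisCovering n π) :
    IsCoveringMapOn π (π '' Ram n π)ᶜ := by
  refine hπ.proper.isClosedMap.isCoveringMapOn_of_isLocalHomeomorphOn
    (fun x _ => hπ.finite_fibre x) (IsLocalHomeomorphOn.mk _ _ fun y hy => ?_)
  obtain ⟨e, he, heq, -⟩ := exists_openPartialHomeomorph_of_notMem_ram hπ.holomorphic
    (fun h => hy (mem_image_of_mem π h))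
  exact ⟨e, he, heq⟩

end LocalInverse

/-! ### Connected sets near a finite fibre. -/

section FibreNeighbourhoods

variable {X Y : Type*} [TopologicalSpace X] [TopologicalSpace Y] [T2Space Y]

/-- A connected set over a small neighbourhood of `x` lies in a prescribed neighbourhood of one
point of the finite fibre over `x`. -/
theorem exists_nhds_preimage_subset {π : Y → X} (hπ : IsClosedMap π) {x : X}
    (hfin : (π ⁻¹' {x}).Finite) (O : Y → Set Y) (hO : ∀ y ∈ π ⁻¹' {x}, O y ∈ 𝓝 y) :
    ∃ W ∈ 𝓝 x, ∀ A : Set Y, A.Nonempty → IsPreconnected A → A ⊆ π ⁻¹' W →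
      ∃ y ∈ π ⁻¹' {x}, A ⊆ O y ∧ ∀ y' ∈ A, π y' = x → y' = y := by
  obtain ⟨T, hT, hdisj⟩ := hfin.t2_separation
  set V : Y → Set Y := fun y => interior (O y) ∩ T y with hV
  have hVo : ∀ y, IsOpen (V y) := fun y => isOpen_interior.inter (hT y).2
  have hVm : ∀ y ∈ π ⁻¹' {x}, y ∈ V y := fun y hy =>
    ⟨mem_interior_iff_mem_nhds.2 (hO y hy), (hT y).1⟩
  -- Disjoint neighbourhoods of the fibre points cover the preimage of some `W`, because `π` is
  -- closed; a connected set over `W` then lies in just one of them.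
  have hmem : (⋃ y ∈ π ⁻¹' {x}, V y) ∈ 𝓝ˢ (π ⁻¹' {x}) :=
    (isOpen_biUnion fun y _ => hVo y).mem_nhdsSet.2 fun y hy => mem_biUnion hy (hVm y hy)
  obtain ⟨W, hW, hWV⟩ := isClosedMap_iff_comap_nhds_le.1 hπ hmem
  refine ⟨W, hW, fun A hA hAc hAW => ?_⟩
  obtain ⟨a, ha⟩ := hA
  obtain ⟨y, hy, hay⟩ := mem_iUnion₂.1 (hWV (hAW ha))
  have hsub : A ⊆ V y := by
    have hcov : A ⊆ V y ∪ ⋃ y' ∈ (π ⁻¹' {x}) \ {y}, V y' := by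
      intro b hb
      obtain ⟨y', hy', hby'⟩ := mem_iUnion₂.1 (hWV (hAW hb))
      by_cases h : y' = y
      · exact Or.inl (h ▸ hby')
      · exact Or.inr (mem_biUnion ⟨hy', h⟩ hby')
    have hd : Disjoint (V y) (⋃ y' ∈ (π ⁻¹' {x}) \ {y}, V y') := by
      refine disjoint_iUnion₂_right.2 fun y' hy' => ?_
      exact (hdisj hy hy'.1 (Ne.symm hy'.2)).mono inter_subset_right inter_subset_right
    exact hAc.subset_left_of_subset_union (hVo y) (isOpen_biUnion fun y' _ => hVo y') hd hcov
      ⟨a, ha, hay⟩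
  refine ⟨y, hy, fun b hb => interior_subset (hsub hb).1, fun b hb hbx => ?_⟩
  by_contra hne
  exact disjoint_left.1 (hdisj (show b ∈ π ⁻¹' {x} from hbx) hy hne) (hT b).1 (hsub hb).2

end FibreNeighbourhoods

/-! ### Moving a curve off a normal crossing hypersurface. -/

section Perturbation

variable {n : ℕ} {X : Type*} [TopologicalSpace X] [ChartedSpace (Fin n → ℂ) X]

/-- A germ of a curve is a limit of curves which, off the origin, avoid a given normal crossing
hypersurface. -/
theorem IsNormalCrossing.exists_perturbation {B : Set X} (hB : IsNormalCrossing n B) {f : ℂ → X}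
    (hf : ∀ᶠ t in 𝓝 (0 : ℂ), ContMDiffAt 𝓘(ℂ) 𝓘(ℂ, Fin n → ℂ) ω f t) {W : Set X}
    (hW : W ∈ 𝓝 (f 0)) :
    ∃ ε > 0, ∃ r > 0, ∃ E : ℝ → ℂ → X,
      ContinuousOn (fun q : ℝ × ℂ => E q.1 q.2) (Ioo 0 ε ×ˢ (Metric.ball 0 r \ {0})) ∧
      (∀ τ ∈ Ioo 0 ε, ∀ t ∈ Metric.ball (0 : ℂ) r \ {0}, E τ t ∈ W ∧ E τ t ∉ B ∧
        ContMDiffAt 𝓘(ℂ) 𝓘(ℂ, Fin n → ℂ) ω (E τ) t) ∧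
      ∀ t ∈ Metric.ball (0 : ℂ) r \ {0}, Tendsto (fun τ => E τ t) (𝓝[>] 0) (𝓝 (f t)) := by
  classical
  obtain ⟨h, φ, S, ⟨hφ, hxφ, hφ0⟩, hS⟩ := hB (f 0)
  set F : ℂ → Fin n → ℂ := fun t => φ (f t) with hF
  have hf0 := hf.self_of_nhds
  have hsrc : ∀ᶠ t in 𝓝 (0 : ℂ), f t ∈ φ.source :=
    hf0.continuousAt.preimage_mem_nhds (φ.open_source.mem_nhds hxφ)
  have hFc : ∀ t, ContMDiffAt 𝓘(ℂ) 𝓘(ℂ, Fin n → ℂ) ω f t → f t ∈ φ.source →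
      ContDiffAt ℂ ω F t := fun t h1 h2 =>
    ContMDiffAt.contDiffAt ((contMDiffAt_of_mem_maximalAtlas hφ h2).comp t h1)
  have hF0 : ContDiffAt ℂ ω F 0 := hFc 0 hf0 hxφ
  have hFl : ∀ l, AnalyticAt ℂ (fun t => F t l) 0 := fun l =>
    ((contDiffAt_pi.1 hF0) l).analyticAt
  -- Only the equations that vanish identically along the curve are shifted, and they become the
  -- nonzero constant `τ`. The others are kept, having no zero near the origin except possibly the
  -- origin itself.
  set v : Fin n → ℂ := fun l => if l ∈ S ∧ ∀ᶠ t in 𝓝 (0 : ℂ), F t l = 0 then 1 else 0 with hv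
  set c : ℝ → ℂ → Fin n → ℂ := fun τ t => F t + (τ : ℂ) • v with hc
  have hc0 : c 0 0 = 0 := by simp [hc, hF, hφ0]
  have hcc : ContinuousAt (fun q : ℝ × ℂ => c q.1 q.2) (0, 0) := by
    have : ContinuousAt (fun q : ℝ × ℂ => F q.2) (0, 0) :=
      ContinuousAt.comp (g := F) (f := Prod.snd) hF0.continuousAt continuousAt_snd
    exact this.add (by fun_prop)
  have htgt : ∀ᶠ q : ℝ × ℂ in 𝓝 (0, 0), c q.1 q.2 ∈ φ.target ∧ φ.symm (c q.1 q.2) ∈ W := by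
    have h1 : φ.target ∩ φ.symm ⁻¹' W ∈ 𝓝 (c 0 0) := by
      have h0 : c 0 0 = φ (f 0) := by rw [hc0, hφ0]
      rw [h0]
      refine inter_mem (φ.open_target.mem_nhds (φ.map_source hxφ)) ?_
      apply (φ.continuousAt_symm (φ.map_source hxφ)).preimage_mem_nhds
      rwa [φ.left_inv hxφ]
    exact hcc.preimage_mem_nhds h1
  have hne : ∀ᶠ t in 𝓝 (0 : ℂ), t ≠ 0 → ∀ l ∈ S, ∀ τ : ℝ, τ ≠ 0 → c τ t l ≠ 0 := by
    have : ∀ l, ∀ᶠ t in 𝓝 (0 : ℂ), t ≠ 0 → l ∈ S → ∀ τ : ℝ, τ ≠ 0 → c τ t l ≠ 0 := by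
      intro l
      by_cases h0 : ∀ᶠ t in 𝓝 (0 : ℂ), F t l = 0
      · filter_upwards [h0] with t ht _ hl τ hτ
        have hvl : v l = 1 := by simp only [hv]; exact if_pos ⟨hl, h0⟩
        simp [hc, ht, hvl, hτ]
      · have h1 := ((hFl l).eventually_eq_zero_or_eventually_ne_zero).resolve_left h0
        rw [eventually_nhdsWithin_iff] at h1
        filter_upwards [h1] with t ht ht0 hl τ hτ
        have hvl : v l = 0 := by simp only [hv]; exact if_neg fun h => h0 h.2
        simpa [hc, hvl] using ht ht0
    filter_upwards [eventually_all.2 this] with t ht ht0 l hl using ht l ht0 hl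
  obtain ⟨ε, hε, hε'⟩ := Metric.eventually_nhds_iff_ball.1 htgt
  obtain ⟨r, hr, hr'⟩ := Metric.eventually_nhds_iff_ball.1 (hne.and (hf.and hsrc))
  have hdom : ∀ τ ∈ Ico 0 ε, ∀ t ∈ Metric.ball (0 : ℂ) (min ε r),
      c τ t ∈ φ.target ∧ φ.symm (c τ t) ∈ W := by
    intro τ hτ t ht
    refine hε' (τ, t) ?_
    rw [mem_ball_zero_iff] at ht
    rw [Metric.mem_ball, Prod.dist_eq, max_lt_iff]
    simp only [dist_zero_right, Real.norm_eq_abs, abs_of_nonneg hτ.1]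
    exact ⟨hτ.2, ht.trans_le (min_le_left _ _)⟩
  have hball : ∀ t ∈ Metric.ball (0 : ℂ) (min ε r), t ∈ Metric.ball (0 : ℂ) r := fun t ht =>
    Metric.ball_subset_ball (min_le_right _ _) ht
  have hFd : ∀ t ∈ Metric.ball (0 : ℂ) (min ε r), ContDiffAt ℂ ω F t := fun t ht =>
    hFc t (hr' t (hball t ht)).2.1 (hr' t (hball t ht)).2.2
  refine ⟨ε, hε, min ε r, lt_min hε hr, fun τ t => φ.symm (c τ t), ?_, ?_, ?_⟩
  · refine φ.continuousOn_symm.comp ?_ fun q hq => (hdom q.1 ⟨hq.1.1.le, hq.1.2⟩ q.2 hq.2.1).1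
    intro q hq
    refine ContinuousAt.continuousWithinAt ?_
    have : ContinuousAt (fun q : ℝ × ℂ => F q.2) q :=
      ContinuousAt.comp (g := F) (f := Prod.snd) (hFd q.2 hq.2.1).continuousAt continuousAt_snd
    exact this.add (by fun_prop)
  · intro τ hτ t ht
    obtain ⟨h1, h2⟩ := hdom τ ⟨hτ.1.le, hτ.2⟩ t ht.1
    refine ⟨h2, ?_, ?_⟩
    · have hs := hS _ (φ.map_target h1)
      rw [hs.2, hs.1, φ.right_inv h1, Finset.prod_eq_zero_iff]
      rintro ⟨l, hl, h0⟩
      exact (hr' t (hball t ht.1)).1 ht.2 l hl τ hτ.1.ne' h0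
    · refine ContMDiffAt.comp t (contMDiffAt_symm_of_mem_maximalAtlas hφ h1) ?_
      exact ((hFd t ht.1).add contDiffAt_const).contMDiffAt
  · intro t ht
    have h1 := (hdom 0 ⟨le_rfl, hε⟩ t ht.1).1
    have h2 : φ.symm (c 0 t) = f t := by
      simp only [hc, hF, Complex.ofReal_zero, zero_smul, add_zero]
      exact φ.left_inv (hr' t (hball t ht.1)).2.2
    rw [← h2]
    refine (φ.continuousAt_symm h1).tendsto.comp ?_
    have : Continuous fun τ : ℝ => c τ t := by fun_prop
    exact (this.tendsto 0).mono_left nhdsWithin_le_nhds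

end Perturbation

/-! ### Existence of lifts after a base change `t = s ^ N`. -/

section RamifiedLift

/-- A family of maps of the punctured disc to the base of a covering with finite fibres lifts
through the exponential, and the lift has a period `2 π i N`. -/
theorem exists_periodic_lift_exp {X Y : Type*} [TopologicalSpace X] [TopologicalSpace Y]
    {π : Y → X} {s : Set X} (cov : IsCoveringMapOn π s) (hsurj : Function.Surjective π)
    (hfin : ∀ x, (π ⁻¹' {x}).Finite) {ε r : ℝ} (hε : 0 < ε) (hr : 0 < r) {E : ℝ → ℂ → X}
    (hE : ContinuousOn (fun q : ℝ × ℂ => E q.1 q.2) (Ioo 0 ε ×ˢ (Metric.ball 0 r \ {0})))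
    (hs : ∀ τ ∈ Ioo 0 ε, ∀ t ∈ Metric.ball (0 : ℂ) r \ {0}, E τ t ∈ s) :
    ∃ N : ℕ, 0 < N ∧ ∃ L : ℝ × ℂ → Y,
      ContinuousOn L {q | q.1 ∈ Ioo 0 ε ∧ ‖Complex.exp q.2‖ < r} ∧
      IsPreconnected {q : ℝ × ℂ | q.1 ∈ Ioo 0 ε ∧ ‖Complex.exp q.2‖ < r} ∧
      ∀ τ ∈ Ioo 0 ε, ∀ β, ‖Complex.exp β‖ < r → π (L (τ, β)) = E τ (Complex.exp β) ∧
        L (τ, β + N * (2 * Real.pi * Complex.I)) = L (τ, β) := by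
  classical
  set A : Set (ℝ × ℂ) := {q | q.1 ∈ Ioo 0 ε ∧ ‖Complex.exp q.2‖ < r} with hA
  -- The exponential unrolls the punctured disc to a half-plane; with the parameter interval this is
  -- a convex domain, over which lifts exist and are unique.
  have hAeq : A = Ioo 0 ε ×ˢ {β : ℂ | β.re < Real.log r} := by
    ext q
    simp only [hA, mem_ofPred_eq, mem_prod, Complex.norm_exp, Real.lt_log_iff_exp_lt hr]
  have hconv : Convex ℝ A := by
    rw [hAeq]; exact (convex_Ioo 0 ε).prod (convex_halfSpace_re_lt _)
  have hopen : IsOpen A := by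
    rw [hAeq]; exact isOpen_Ioo.prod (isOpen_lt Complex.continuous_re continuous_const)
  have hexp : ∀ (k : ℤ) (β : ℂ), Complex.exp (β + k * (2 * Real.pi * Complex.I)) = Complex.exp β :=
    fun k β => by simpa using Complex.exp_periodic.int_mul k β
  have hmem : ∀ (k : ℤ) (q : ℝ × ℂ), q ∈ A →
      (q.1, q.2 + k * (2 * Real.pi * Complex.I)) ∈ A := fun k q hq =>
    ⟨hq.1, by rw [hexp]; exact hq.2⟩
  obtain ⟨b, hb⟩ : ∃ b : ℂ, ‖Complex.exp b‖ < r :=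
    ⟨((Real.log r - 1 : ℝ) : ℂ), by
      rw [Complex.norm_exp, Complex.ofReal_re, ← Real.lt_log_iff_exp_lt hr]; linarith⟩
  have ha₀ : ((ε / 2, b) : ℝ × ℂ) ∈ A := ⟨⟨by positivity, by dsimp only; linarith⟩, hb⟩
  set a₀ : A := ⟨(ε / 2, b), ha₀⟩
  have : ContractibleSpace A := hconv.contractibleSpace ⟨_, ha₀⟩
  have : LocallyPathConnectedSpace A := hopen.locallyPathConnectedSpace
  have hin : ∀ q ∈ A, (q.1, Complex.exp q.2) ∈ Ioo 0 ε ×ˢ (Metric.ball (0 : ℂ) r \ {0}) :=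
    fun q hq => ⟨hq.1, by simpa using hq.2, Complex.exp_ne_zero _⟩
  let e : C(A, X) := ⟨fun q => E q.1.1 (Complex.exp q.1.2), by
    have : ContinuousOn (fun q : ℝ × ℂ => E q.1 (Complex.exp q.2)) A :=
      hE.comp (f := fun q : ℝ × ℂ => (q.1, Complex.exp q.2)) (by fun_prop) hin
    exact continuousOn_iff_continuous_domRestrict.1 this⟩
  have hes : ∀ a, e a ∈ s := fun a => hs _ a.2.1 _ (hin a.1 a.2).2
  obtain ⟨e₀, he₀⟩ := hsurj (e a₀)
  obtain ⟨F, ⟨-, hF⟩, -⟩ := cov.existsUnique_continuousMap_lifts e he₀ hes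
  have hF' : ∀ a, π (F a) = e a := fun a => congrFun hF a
  let T : ℤ → C(A, A) := fun k => ⟨fun q => ⟨_, hmem k q.1 q.2⟩, by fun_prop⟩
  have heT : ∀ k a, e (T k a) = e a := fun k a => by
    change E a.1.1 (Complex.exp (a.1.2 + k * (2 * Real.pi * Complex.I))) = _
    rw [hexp]; rfl
  -- The translates of the base point by `2πik` have the same image under `e`, whose fibre is
  -- finite, so the lift repeats a value. Uniqueness of lifts turns the repetition into a period,
  -- valid for all `τ` at once.
  obtain ⟨k, k', hkk', hkeq⟩ := (hfin (e a₀)).exists_lt_map_eq_of_forall_mem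
    (f := fun k : ℕ => F (T k a₀)) fun k => by
      rw [mem_preimage, hF', heT]; rfl
  have hFT : F.comp (T k) = F.comp (T k') := by
    refine (cov.existsUnique_continuousMap_lifts e (a₀ := a₀) (e₀ := F (T k a₀)) ?_ hes).unique
      ⟨rfl, ?_⟩ ⟨hkeq.symm, ?_⟩
    · rw [hF', heT]
    · funext a; exact (hF' _).trans (heT _ _)
    · funext a; exact (hF' _).trans (heT _ _)
  refine ⟨k' - k, Nat.sub_pos_of_lt hkk', fun q => if h : q ∈ A then F ⟨q, h⟩ else e₀, ?_,
    hconv.isPreconnected, ?_⟩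
  · rw [continuousOn_iff_continuous_domRestrict]
    refine F.continuous.congr fun a => ?_
    simp
  · intro τ hτ β hβ
    have h1 : ((τ, β) : ℝ × ℂ) ∈ A := ⟨hτ, hβ⟩
    have h2 : ((τ, β + ((k' - k : ℕ) : ℂ) * (2 * Real.pi * Complex.I)) : ℝ × ℂ) ∈ A := by
      simpa using hmem ((k' - k : ℕ) : ℤ) _ h1
    simp only [dif_pos h1, dif_pos h2]
    refine ⟨hF' ⟨_, h1⟩, ?_⟩
    have h3 := congrArg (fun G : C(A, Y) => G (T (-(k : ℤ)) ⟨_, h1⟩)) hFT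
    have e1 : T k (T (-(k : ℤ)) ⟨_, h1⟩) = ⟨_, h1⟩ := by
      apply Subtype.ext
      change (τ, β + _ + _) = (τ, β)
      simp
    have e2 : T k' (T (-(k : ℤ)) ⟨_, h1⟩) = ⟨_, h2⟩ := by
      apply Subtype.ext
      change (τ, β + _ + _) = (τ, _)
      rw [Nat.cast_sub hkk'.le]
      push_cast
      ring_nf
    simp only [ContinuousMap.comp_apply] at h3
    rw [e1, e2] at h3
    exact h3.symm

variable {n : ℕ} {X : Type*} [TopologicalSpace X] [T2Space X] [ChartedSpace (Fin n → ℂ) X]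
  [IsManifold 𝓘(ℂ, Fin n → ℂ) ω X]
  {Y : Type*} [TopologicalSpace Y] [T2Space Y] [ChartedSpace (Fin n → ℂ) Y]
  [IsManifold 𝓘(ℂ, Fin n → ℂ) ω Y]

/-- A germ of a holomorphic curve lifts through a Galois covering with normal crossing branch
locus after a base change `t = s ^ N`. -/
theorem IsGaloisCovering.exists_ramified_lift {π : Y → X} (hπ : IsGaloisCovering n π)
    (hB : IsNormalCrossing n (π '' Ram n π)) {f : ℂ → X}
    (hf : ∀ᶠ t in 𝓝 (0 : ℂ), ContMDiffAt 𝓘(ℂ) 𝓘(ℂ, Fin n → ℂ) ω f t) :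
    ∃ N : ℕ, 0 < N ∧ ∃ σ : ℝ, 0 < σ ∧ ∃ g : ℂ → Y, ∀ s ∈ Metric.ball (0 : ℂ) σ,
      ContMDiffAt 𝓘(ℂ) 𝓘(ℂ, Fin n → ℂ) ω g s ∧ π (g s) = f (s ^ N) := by
  -- A closed ball inside the chart target keeps the Montel limit in the chart.
  have hrad : ∀ y : Y, ∃ R > 0, Metric.closedBall (chartAt (Fin n → ℂ) y y) R ⊆
      (chartAt (Fin n → ℂ) y).target := fun y =>
    Metric.nhds_basis_closedBall.mem_iff.1
      ((chartAt (Fin n → ℂ) y).open_target.mem_nhds (mem_chart_target _ y))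
  choose R hR hRt using hrad
  obtain ⟨W, hW, hWA⟩ := exists_nhds_preimage_subset hπ.proper.isClosedMap
    (hπ.finite_fibre (f 0))
    (fun y => (chartAt (Fin n → ℂ) y).source ∩
      chartAt (Fin n → ℂ) y ⁻¹' Metric.ball (chartAt (Fin n → ℂ) y y) (R y))
    (fun y _ => inter_mem (chart_source_mem_nhds _ y)
      ((mem_chart_source _ y |> (chartAt (Fin n → ℂ) y).continuousAt).preimage_mem_nhds
        (Metric.ball_mem_nhds _ (hR y))))
  obtain ⟨ε, hε, r, hr, E, hEc, hE, hElim⟩ := hB.exists_perturbation hf hW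
  obtain ⟨N, hN, L, hLc, hconn, hL⟩ := exists_periodic_lift_exp hπ.isCoveringMapOn hπ.surjective
    hπ.finite_fibre hε hr hEc (fun τ hτ t ht => (hE τ hτ t ht).2.1)
  have hmem : ∀ β : ℂ, ‖Complex.exp β‖ < r → Complex.exp β ∈ Metric.ball (0 : ℂ) r \ {0} :=
    fun β hβ => ⟨by simpa using hβ, Complex.exp_ne_zero _⟩
  have hopen : IsOpen {q : ℝ × ℂ | q.1 ∈ Ioo 0 ε ∧ ‖Complex.exp q.2‖ < r} :=
    (isOpen_Ioo.preimage continuous_fst).inter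
      (isOpen_lt (by fun_prop : Continuous fun q : ℝ × ℂ => ‖Complex.exp q.2‖) continuous_const)
  have hLd : ∀ τ ∈ Ioo 0 ε, ∀ β, ‖Complex.exp β‖ < r →
      ContMDiffAt 𝓘(ℂ) 𝓘(ℂ, Fin n → ℂ) ω (fun β => L (τ, β)) β := by
    intro τ hτ β hβ
    have hLβ := (hL τ hτ β hβ).1
    have hyR : L (τ, β) ∉ Ram n π := fun h => by
      refine (hE τ hτ _ (hmem β hβ)).2.1 ?_
      rw [← hLβ]; exact mem_image_of_mem π h
    obtain ⟨e, he, heq, hsymm⟩ := exists_openPartialHomeomorph_of_notMem_ram hπ.holomorphic hyR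
    have hcont : ContinuousAt (fun β => L (τ, β)) β :=
      ContinuousAt.comp (g := L) (f := fun β => (τ, β))
        (hLc.continuousAt (hopen.mem_nhds ⟨hτ, hβ⟩)) (by fun_prop)
    have hev : (fun β => L (τ, β)) =ᶠ[𝓝 β] fun β => e.symm (E τ (Complex.exp β)) := by
      have h1 : ∀ᶠ β' in 𝓝 β, L (τ, β') ∈ e.source :=
        hcont.preimage_mem_nhds (e.open_source.mem_nhds he)
      have h2 : ∀ᶠ β' in 𝓝 β, ‖Complex.exp β'‖ < r :=
        (isOpen_lt (by fun_prop : Continuous fun β' : ℂ => ‖Complex.exp β'‖)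
          continuous_const).mem_nhds hβ
      filter_upwards [h1, h2] with β' h3 h4
      rw [← (hL τ hτ β' h4).1, heq h3, e.left_inv h3]
    refine ContMDiffAt.congr_of_eventuallyEq ?_ hev
    rw [hLβ] at hsymm
    refine ContMDiffAt.comp β hsymm ?_
    refine ContMDiffAt.comp β (hE τ hτ _ (hmem β hβ)).2.2 ?_
    exact Complex.contDiff_exp.contDiffAt.contMDiffAt
  obtain ⟨b, hb⟩ : ∃ b : ℂ, ‖Complex.exp b‖ < r :=
    ⟨((Real.log r - 1 : ℝ) : ℂ), by
      rw [Complex.norm_exp, Complex.ofReal_re, ← Real.lt_log_iff_exp_lt hr]; linarith⟩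
  -- All perturbed lifts together form one connected image, so they share a single bounded chart.
  obtain ⟨y, hy, hLy, -⟩ := hWA (L '' {q | q.1 ∈ Ioo 0 ε ∧ ‖Complex.exp q.2‖ < r})
    ⟨_, mem_image_of_mem L (show ((ε / 2, b) : ℝ × ℂ) ∈ _ from
      ⟨⟨by positivity, by dsimp only; linarith⟩, hb⟩)⟩ (hconn.image L hLc) (by
        rintro _ ⟨⟨τ, β⟩, ⟨hτ, hβ⟩, rfl⟩
        rw [mem_preimage, (hL τ hτ β hβ).1]
        exact (hE τ hτ _ (hmem β hβ)).1)
  set ψ := chartAt (Fin n → ℂ) y with hψ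
  have hψm : ψ ∈ IsManifold.maximalAtlas 𝓘(ℂ, Fin n → ℂ) ω Y := IsManifold.chart_mem_maximalAtlas y
  have hLO : ∀ τ ∈ Ioo 0 ε, ∀ β, ‖Complex.exp β‖ < r →
      L (τ, β) ∈ ψ.source ∧ ψ (L (τ, β)) ∈ Metric.closedBall (ψ y) (R y) := fun τ hτ β hβ => by
    have := hLy (mem_image_of_mem L (show ((τ, β) : ℝ × ℂ) ∈ _ from ⟨hτ, hβ⟩))
    exact ⟨this.1, Metric.ball_subset_closedBall this.2⟩
  -- With `σ ≤ 1` one has `‖s‖ ^ N ≤ ‖s‖ < r`.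
  set σ := min 1 r with hσ
  have hσ0 : 0 < σ := lt_min one_pos hr
  have hpow : ∀ x : ℝ, 0 ≤ x → x < σ → x ^ N < r := fun x hx hxσ =>
    calc x ^ N ≤ x := pow_le_of_le_one hx (hxσ.le.trans (min_le_left _ _)) hN.ne'
      _ < r := hxσ.trans_le (min_le_right _ _)
  have hNexp : ∀ β : ℂ, ‖Complex.exp β‖ < σ → ‖Complex.exp (N * β)‖ < r := fun β hβ => by
    rw [Complex.exp_nat_mul, norm_pow]
    exact hpow _ (norm_nonneg _) hβ
  have hlog : ∀ s ∈ Metric.ball (0 : ℂ) σ \ {0}, ‖Complex.exp (Complex.log s)‖ < σ :=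
    fun s hs => by rw [Complex.exp_log hs.2]; simpa using hs.1
  -- The shift by `2` keeps even the first parameter strictly below `ε`.
  set τ : ℕ → ℝ := fun m => ε / (m + 2) with hτdef
  have hτ : ∀ m, τ m ∈ Ioo 0 ε := fun m => ⟨by positivity, by
    rw [hτdef]; exact div_lt_self hε (by norm_cast; omega)⟩
  have hτlim : Tendsto τ (hyperfilter ℕ : Filter ℕ) (𝓝[>] 0) := by
    refine Tendsto.mono_left ?_ Nat.hyperfilter_le_atTop
    refine tendsto_nhdsWithin_iff.2 ⟨?_, Eventually.of_forall fun m => (hτ m).1⟩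
    exact tendsto_const_nhds.div_atTop
      (tendsto_atTop_add_const_right _ _ tendsto_natCast_atTop_atTop)
  -- Substituting `N log s` turns the period `2πiN` of the lift into the period `2πi` of the
  -- logarithm.
  have hFd : ∀ m, DifferentiableOn ℂ (fun s => ψ (L (τ m, N * Complex.log s)))
      (Metric.ball 0 σ \ {0}) := by
    intro m
    refine differentiableOn_comp_log_of_periodic (h := fun β => ψ (L (τ m, N * β))) ?_ ?_
    · intro β hβ
      have h1 := hLd _ (hτ m) _ (hNexp β hβ)
      have h2 : ContMDiffAt 𝓘(ℂ) 𝓘(ℂ) ω (fun β : ℂ => (N : ℂ) * β) β :=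
        (contDiff_const.mul contDiff_id).contDiffAt.contMDiffAt
      have h3 := (contMDiffAt_of_mem_maximalAtlas hψm (hLO _ (hτ m) _ (hNexp β hβ)).1).comp β
        (ContMDiffAt.comp β h1 h2)
      exact h3.contDiffAt.differentiableAt (by simp)
    · intro β hβ
      have := (hL _ (hτ m) _ (hNexp β hβ)).2
      simp only [mul_add]
      rw [this]
  obtain ⟨G, hGd, hG⟩ := exists_differentiableOn_tendsto_ultrafilter
    (Metric.isOpen_ball.sdiff isClosed_singleton) hFd (c := ψ y) (R := R y)
    (fun m s hs => (hLO _ (hτ m) _ (hNexp _ (hlog s hs))).2) (hyperfilter ℕ)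
  have hball : Metric.ball (0 : ℂ) σ ∈ 𝓝 (0 : ℂ) := Metric.ball_mem_nhds _ hσ0
  set G' := Function.update G 0 (limUnder (𝓝[≠] 0) G) with hG'
  have hG'd : DifferentiableOn ℂ G' (Metric.ball 0 σ) := by
    refine Complex.differentiableOn_update_limUnder_of_bddAbove hball hGd
      ⟨‖ψ y‖ + R y, ?_⟩
    rintro _ ⟨s, hs, rfl⟩
    have h1 := (hG s hs).1
    rw [mem_closedBall_iff_norm] at h1
    have h2 := norm_add_le (G s - ψ y) (ψ y)
    rw [sub_add_cancel] at h2
    simp only [Function.comp_apply]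
    linarith
  have hG'eq : ∀ s, s ≠ 0 → G' s = G s := fun s hs => Function.update_of_ne hs _ _
  have hG'c : ∀ s ∈ Metric.ball (0 : ℂ) σ, ContinuousAt G' s := fun s hs =>
    (hG'd.differentiableAt (Metric.isOpen_ball.mem_nhds hs)).continuousAt
  have hpunct : ∀ᶠ s in 𝓝[≠] (0 : ℂ), s ∈ Metric.ball (0 : ℂ) σ \ {0} := by
    filter_upwards [nhdsWithin_le_nhds hball, self_mem_nhdsWithin] with s h1 h2 using ⟨h1, h2⟩
  have hG'm : ∀ s ∈ Metric.ball (0 : ℂ) σ, G' s ∈ Metric.closedBall (ψ y) (R y) := by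
    intro s hs
    by_cases h0 : s = 0
    · subst h0
      refine Metric.isClosed_closedBall.mem_of_tendsto
        ((hG'c 0 hs).tendsto.mono_left (nhdsWithin_le_nhds (s := {0}ᶜ))) ?_
      filter_upwards [hpunct] with s hs
      rw [hG'eq s hs.2]; exact (hG s hs).1
    · rw [hG'eq s h0]; exact (hG s ⟨hs, h0⟩).1
  have hgd : ∀ s ∈ Metric.ball (0 : ℂ) σ,
      ContMDiffAt 𝓘(ℂ) 𝓘(ℂ, Fin n → ℂ) ω (fun s => ψ.symm (G' s)) s := by
    intro s hs
    refine ContMDiffAt.comp s (contMDiffAt_symm_of_mem_maximalAtlas hψm (hRt y (hG'm s hs))) ?_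
    exact ((hG'd.analyticAt (Metric.isOpen_ball.mem_nhds hs)).contDiffAt).contMDiffAt
  have hpunct_eq : ∀ s ∈ Metric.ball (0 : ℂ) σ \ {0}, π (ψ.symm (G' s)) = f (s ^ N) := by
    intro s hs
    have hs0 : s ≠ 0 := hs.2
    have hsN : s ^ N ∈ Metric.ball (0 : ℂ) r \ {0} := by
      refine ⟨?_, pow_ne_zero _ hs0⟩
      rw [mem_ball_zero_iff, norm_pow]
      exact hpow _ (norm_nonneg _) (by simpa using hs.1)
    have hcts : ContinuousAt (fun u => π (ψ.symm u)) (G s) :=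
      ContinuousAt.comp (g := π) hπ.holomorphic.continuous.continuousAt
        (ψ.continuousAt_symm (hRt y (hG s hs).1))
    rw [hG'eq s hs0]
    -- Both sides are limits of the perturbed curves at `s ^ N`.
    refine tendsto_nhds_unique (hcts.tendsto.comp (hG s hs).2) ?_
    refine ((hElim _ hsN).comp hτlim).congr fun m => ?_
    have h1 := hNexp _ (hlog s hs)
    simp only [Function.comp_apply]
    rw [ψ.left_inv (hLO _ (hτ m) _ h1).1, (hL _ (hτ m) _ h1).1, Complex.exp_nat_mul,
      Complex.exp_log hs0]
  refine ⟨N, hN, σ, hσ0, fun s => ψ.symm (G' s), fun s hs => ⟨hgd s hs, ?_⟩⟩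
  by_cases h0 : s = 0
  · subst h0
    have h1 : Tendsto (fun s => π (ψ.symm (G' s))) (𝓝[≠] 0) (𝓝 (π (ψ.symm (G' 0)))) :=
      (ContinuousAt.comp (g := π) hπ.holomorphic.continuous.continuousAt
        (hgd 0 hs).continuousAt).tendsto.mono_left nhdsWithin_le_nhds
    have h2 : Tendsto (fun s : ℂ => f (s ^ N)) (𝓝[≠] 0) (𝓝 (f (0 ^ N))) := by
      refine (ContinuousAt.tendsto (x := (0 : ℂ)) (f := fun s : ℂ => f (s ^ N))
        (ContinuousAt.comp (g := f) (f := fun s : ℂ => s ^ N) ?_ (by fun_prop))).mono_left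
        nhdsWithin_le_nhds
      rw [zero_pow hN.ne']
      exact hf.self_of_nhds.continuousAt
    refine tendsto_nhds_unique (h1.congr' ?_) h2
    filter_upwards [hpunct] with s hs using hpunct_eq s hs
  · exact hpunct_eq s ⟨hs, h0⟩

end RamifiedLift

theorem isProperMap_pow {N : ℕ} (hN : 0 < N) : IsProperMap fun s : ℂ => s ^ N := by
  rw [isProperMap_iff_tendsto_cocompact]
  refine ⟨by fun_prop, ?_⟩
  rw [← Metric.cobounded_eq_cocompact, ← tendsto_norm_atTop_iff_cobounded]
  simp only [norm_pow]
  exact (tendsto_pow_atTop hN.ne').comp tendsto_norm_cobounded_atTop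

variable {n : ℕ} {X : Type*} {Y : Type*} [TopologicalSpace Y] [ChartedSpace (Fin n → ℂ) Y]

/-- A lift of `f (s ^ N)` is a lifting diagram of `f`. -/
theorem LiftingDiagram.nonempty_of_lift_pow {π : Y → X} {f : ℂ → X} {N : ℕ} (hN : 0 < N)
    {r : ℝ} (hr : 0 < r) {g : ℂ → Y}
    (hg : ∀ s : ℂ, ‖s‖ ^ N < r → ContMDiffAt 𝓘(ℂ) 𝓘(ℂ, Fin n → ℂ) ω g s ∧ π (g s) = f (s ^ N)) :
    Nonempty (LiftingDiagram n π f r) := by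
  set pw : ℂ → ℂ := fun s => s ^ N with hpw
  let V : TopologicalSpace.Opens ℂ :=
    ⟨pw ⁻¹' Metric.ball 0 r, Metric.isOpen_ball.preimage (by fun_prop)⟩
  have hV : ∀ s : ℂ, s ∈ V ↔ ‖s‖ ^ N < r := fun s => by
    change s ^ N ∈ Metric.ball (0 : ℂ) r ↔ _
    rw [mem_ball_zero_iff, norm_pow]
  have hconn : ConnectedSpace V := by
    -- The preimage of the disc under the power map is again a disc, hence connected.
    have h1 : (V : Set ℂ) = Metric.ball 0 (r ^ (N : ℝ)⁻¹) := by
      ext s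
      rw [SetLike.mem_coe, hV, mem_ball_zero_iff]
      rw [Real.lt_rpow_inv_iff_of_pos (norm_nonneg _) hr.le (by exact_mod_cast hN),
        Real.rpow_natCast]
    refine isConnected_iff_connectedSpace.1 (show IsConnected (V : Set ℂ) from ?_)
    rw [h1]
    exact ⟨⟨0, Metric.mem_ball_self (Real.rpow_pos_of_pos hr _)⟩,
      (convex_ball _ _).isPreconnected⟩
  have hval : ContMDiff 𝓘(ℂ) 𝓘(ℂ) ω (Subtype.val : V → ℂ) := contMDiff_subtype_val
  exact ⟨{
    V := V
    connectedSpace := hconn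
    ρ := (Metric.ball (0 : ℂ) r).restrictPreimage pw
    ρ_holomorphic := by
      have h1 : ContMDiff 𝓘(ℂ) 𝓘(ℂ) ω pw := (contDiff_id.pow N).contMDiff
      exact h1.comp hval
    ρ_proper := (isProperMap_pow hN).restrictPreimage _
    ρ_surjective := by
      rintro ⟨t, ht⟩
      obtain ⟨s, hs⟩ := IsAlgClosed.exists_pow_nat_eq t hN
      exact ⟨⟨s, by rw [hV, ← norm_pow, hs]; simpa using ht⟩, Subtype.ext hs⟩
    g := fun s => g s
    g_holomorphic := fun s => ContMDiffAt.comp s (hg s ((hV s).1 s.2)).1 (hval s)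
    comm := fun s => (hg s ((hV s).1 s.2)).2 }⟩

/-- Germs of curves have lifting diagrams through a Galois covering with normal crossing branch
locus, over every small disc. -/
theorem IsGaloisCovering.eventually_nonempty_liftingDiagram [TopologicalSpace X] [T2Space X]
    [ChartedSpace (Fin n → ℂ) X] [T2Space Y] [IsManifold 𝓘(ℂ, Fin n → ℂ) ω X]
    [IsManifold 𝓘(ℂ, Fin n → ℂ) ω Y] {π : Y → X}
    (hπ : IsGaloisCovering n π) (hB : IsNormalCrossing n (π '' Ram n π)) {f : ℂ → X}
    (hf : ∀ᶠ t in 𝓝 (0 : ℂ), ContMDiffAt 𝓘(ℂ) 𝓘(ℂ, Fin n → ℂ) ω f t) :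
    ∀ᶠ r : ℝ in 𝓝[>] 0, Nonempty (LiftingDiagram n π f r) := by
  obtain ⟨N, hN, σ, hσ, g, hg⟩ := hπ.exists_ramified_lift hB hf
  filter_upwards [Ioo_mem_nhdsGT (show (0 : ℝ) < σ ^ N by positivity)] with r hr
  refine LiftingDiagram.nonempty_of_lift_pow hN hr.1 fun s hs => hg s ?_
  rw [mem_ball_zero_iff]
  exact lt_of_pow_lt_pow_left₀ N hσ.le (hs.trans hr.2)

/-! ### The count of vanishing orders in one variable. -/

section Orders

/-- A quotient of holomorphic functions of one variable is holomorphic if the order of the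
numerator is at least that of the denominator. -/
theorem exists_analyticAt_inv_mul {A B : ℂ → ℂ} {z₀ : ℂ} (hA : AnalyticAt ℂ A z₀)
    (hB : AnalyticAt ℂ B z₀) (hBtop : analyticOrderAt B z₀ ≠ ⊤)
    (hle : analyticOrderAt B z₀ ≤ analyticOrderAt A z₀) :
    ∃ Q : ℂ → ℂ, AnalyticAt ℂ Q z₀ ∧ ∀ᶠ z in 𝓝[≠] z₀, (B z)⁻¹ * A z = Q z := by
  obtain ⟨m, hm⟩ := ENat.ne_top_iff_exists.1 hBtop
  obtain ⟨B₁, hB₁, hB₁0, hBeq⟩ := hB.analyticOrderAt_eq_natCast.1 hm.symm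
  obtain ⟨A₁, hA₁, hAeq⟩ := (natCast_le_analyticOrderAt hA).1 (hm.trans_le hle)
  refine ⟨fun z => (B₁ z)⁻¹ * A₁ z, (hB₁.inv hB₁0).mul hA₁, ?_⟩
  filter_upwards [nhdsWithin_le_nhds hBeq, nhdsWithin_le_nhds hAeq, self_mem_nhdsWithin]
    with z h1 h2 h3
  have h4 : (z - z₀) ^ m ≠ 0 := pow_ne_zero _ (sub_ne_zero.2 h3)
  rw [h1, h2, smul_eq_mul, smul_eq_mul, mul_inv]
  field_simp

/-- The relation between the order of `Fl` and that of an adapted root `w` of `Fl ∘ R`. -/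
theorem exists_order_relation {R Fl w u : ℂ → ℂ} {z₀ : ℂ} {p : ℕ} (hp : 0 < p)
    (hR : AnalyticAt ℂ R z₀) (hRtop : analyticOrderAt (fun z => R z - R z₀) z₀ ≠ ⊤)
    (hFl : AnalyticAt ℂ Fl (R z₀)) (hFltop : analyticOrderAt Fl (R z₀) ≠ ⊤)
    (hw : AnalyticAt ℂ w z₀) (hu : AnalyticAt ℂ u z₀) (hu0 : u z₀ ≠ 0)
    (heq : ∀ᶠ z in 𝓝 z₀, Fl (R z) = u z * w z ^ p) :
    ∃ e μ o : ℕ, 0 < e ∧ analyticOrderAt (fun z => R z - R z₀) z₀ = e ∧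
      analyticOrderAt Fl (R z₀) = μ ∧ analyticOrderAt w z₀ = o ∧ μ * e = p * o := by
  obtain ⟨e, he⟩ := ENat.ne_top_iff_exists.1 hRtop
  obtain ⟨μ, hμ⟩ := ENat.ne_top_iff_exists.1 hFltop
  -- The order of `Fl ∘ R` is computed twice: through the composition, and through the factorization
  -- by `w ^ p`.
  have h1 : analyticOrderAt (Fl ∘ R) z₀ = (μ * e : ℕ) := by
    rw [hFl.analyticOrderAt_comp hR, ← he, ← hμ, ENat.natCast_mul]
  have h2 : analyticOrderAt (Fl ∘ R) z₀ = p • analyticOrderAt w z₀ := by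
    rw [analyticOrderAt_congr (show Fl ∘ R =ᶠ[𝓝 z₀] u * w ^ p from heq),
      analyticOrderAt_mul hu (hw.pow p), analyticOrderAt_pow hw,
      hu.analyticOrderAt_eq_zero.2 hu0, zero_add]
  have hwtop : analyticOrderAt w z₀ ≠ ⊤ := by
    intro h
    rw [h2, h, nsmul_eq_mul, ENat.mul_top (by exact_mod_cast hp.ne')] at h1
    exact ENat.top_ne_natCast _ h1
  obtain ⟨o, ho⟩ := ENat.ne_top_iff_exists.1 hwtop
  refine ⟨e, μ, o, ?_, he.symm, hμ.symm, ho.symm, ?_⟩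
  · have : analyticOrderAt (fun z => R z - R z₀) z₀ ≠ 0 :=
      analyticOrderAt_ne_zero.2 ⟨hR.sub analyticAt_const, sub_self _⟩
    rw [← he] at this
    exact Nat.pos_of_ne_zero (by exact_mod_cast this)
  · rw [h2, ← ho, nsmul_eq_mul] at h1
    exact_mod_cast h1.symm

/-- With `p = a q` and `μ e = p o`, the order of the numerator minus that of the denominator,
multiplied by `a`, is `e j (μ b - a) ≥ 0`. If the truncated exponent of `w` is `0` there is nothing
to cancel; otherwise `j b < a ≤ μ b` forces `j < μ`, so that `j` derivatives lower the order by
exactly `j`. -/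
theorem exists_analyticAt_jet_quotient {R Fl w u : ℂ → ℂ} {z₀ : ℂ} {p a b : ℕ}
    (hdvd : a ∣ p) (ha : 0 < a)
    (hR : AnalyticAt ℂ R z₀) (hRtop : analyticOrderAt (fun z => R z - R z₀) z₀ ≠ ⊤)
    (hFl : AnalyticAt ℂ Fl (R z₀)) (hFltop : analyticOrderAt Fl (R z₀) ≠ ⊤)
    (hw : AnalyticAt ℂ w z₀) (hu : AnalyticAt ℂ u z₀) (hu0 : u z₀ ≠ 0)
    (heq : ∀ᶠ z in 𝓝 z₀, Fl (R z) = u z * w z ^ p)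
    (hab : (a : ℕ∞) ≤ analyticOrderAt Fl (R z₀) * b) (j : ℕ) :
    ∃ Q : ℂ → ℂ, AnalyticAt ℂ Q z₀ ∧
      ∀ᶠ z in 𝓝[≠] z₀, (w z ^ (p - j * p * b / a))⁻¹ * iteratedDeriv j Fl (R z) = Q z := by
  have hD : AnalyticAt ℂ (iteratedDeriv j Fl) (R z₀) := by
    rw [iteratedDeriv_eq_iterate]; exact hFl.iterated_deriv j
  obtain ⟨q, rfl⟩ := hdvd
  have hdiv : j * (a * q) * b / a = j * q * b := by
    rw [show j * (a * q) * b = a * (j * q * b) by ring, Nat.mul_div_cancel_left _ ha]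
  rw [hdiv]
  by_cases hk : a * q - j * q * b = 0
  · rw [hk]
    exact ⟨fun z => iteratedDeriv j Fl (R z), hD.comp hR, by simp⟩
  have hlt : j * q * b < a * q := by omega
  have hq : 0 < q := Nat.pos_of_ne_zero fun h => by simp [h] at hlt
  have hjb : j * b < a := by
    have : j * b * q < a * q := by linarith
    exact lt_of_mul_lt_mul_right this hq.le
  obtain ⟨e, μ, o, he, hRe, hμ, ho, hrel⟩ := exists_order_relation (Nat.mul_pos ha hq) hR hRtop hFl
    hFltop hw hu hu0 heq
  rw [hμ] at hab
  have hab' : a ≤ μ * b := by exact_mod_cast hab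
  have hjμ : j < μ := lt_of_mul_lt_mul_right (hjb.trans_le hab') (Nat.zero_le b)
  have hwk : analyticOrderAt (fun z => w z ^ (a * q - j * q * b)) z₀ =
      ((a * q - j * q * b) * o : ℕ) := by
    have := analyticOrderAt_pow hw (a * q - j * q * b)
    rw [ho, nsmul_eq_mul] at this
    rw [show (fun z => w z ^ (a * q - j * q * b)) = w ^ (a * q - j * q * b) from rfl, this]
    push_cast; rfl
  refine exists_analyticAt_inv_mul (hD.comp hR) (hw.pow _)
    (by rw [hwk]; exact ENat.natCast_ne_top _)
    ?_
  change analyticOrderAt (fun z => w z ^ (a * q - j * q * b)) z₀ ≤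
    analyticOrderAt (iteratedDeriv j Fl ∘ R) z₀
  rw [hwk, hD.analyticOrderAt_comp hR, hRe, iteratedDeriv_eq_iterate,
    analyticOrderAt_iterated_deriv hFl hμ.symm (by omega) hjμ.le, ← ENat.natCast_mul,
    ENat.natCast_le_natCast]
  zify [hlt.le, hjμ.le] at hrel hab' ⊢
  have ha' : (0 : ℤ) < a := by exact_mod_cast ha
  refine le_of_mul_le_mul_left ?_ ha'
  have h1 : (a : ℤ) * ((a * q - j * q * b) * o) = μ * e * (a - j * b) := by rw [hrel]; ring
  rw [h1]
  have h2 : (0 : ℤ) ≤ e * j := by positivity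
  nlinarith [mul_le_mul_of_nonneg_left hab' h2]

/-- The same count with `j = 1`, read backwards: holomorphy of the quotient gives `e (μ b - a) ≥ 0`,
and `e > 0`. Vanishing of `Fl` at the point ensures `μ ≥ 1`, so the derivative has order exactly `μ
- 1`. -/
theorem le_order_mul_of_deriv_eq {R Fl w u Φ : ℂ → ℂ} {z₀ : ℂ} {p a b : ℕ} (hp : 0 < p)
    (hdvd : a ∣ p) (ha : 0 < a) (hba : b ≤ a)
    (hR : AnalyticAt ℂ R z₀) (hRtop : analyticOrderAt (fun z => R z - R z₀) z₀ ≠ ⊤)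
    (hFl : AnalyticAt ℂ Fl (R z₀)) (hFltop : analyticOrderAt Fl (R z₀) ≠ ⊤) (hFl0 : Fl (R z₀) = 0)
    (hw : AnalyticAt ℂ w z₀) (hu : AnalyticAt ℂ u z₀) (hu0 : u z₀ ≠ 0)
    (heq : ∀ᶠ z in 𝓝 z₀, Fl (R z) = u z * w z ^ p) (hΦ : AnalyticAt ℂ Φ z₀)
    (hder : ∀ᶠ z in 𝓝[≠] z₀, (w z ^ (p - p * b / a))⁻¹ * deriv Fl (R z) = Φ z) :
    (a : ℕ∞) ≤ analyticOrderAt Fl (R z₀) * b := by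
  obtain ⟨e, μ, o, he, hRe, hμ, ho, hrel⟩ := exists_order_relation hp hR hRtop hFl hFltop hw hu hu0
    heq
  obtain ⟨q, rfl⟩ := hdvd
  have hdiv : a * q * b / a = q * b := by rw [mul_assoc, Nat.mul_div_cancel_left _ ha]
  rw [hdiv] at hder
  have hμ0 : μ ≠ 0 := by
    rintro rfl
    exact (hFl.analyticOrderAt_ne_zero.2 hFl0) (by rw [hμ]; rfl)
  obtain ⟨ν, rfl⟩ := Nat.exists_eq_succ_of_ne_zero hμ0
  have hdord : analyticOrderAt (deriv Fl) (R z₀) = ν :=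
    analyticOrderAt_deriv_of_pos hFl (by rw [hμ]; push_cast; rfl)
  have hw0 : ∀ᶠ z in 𝓝[≠] z₀, w z ≠ 0 := by
    refine hw.eventually_eq_zero_or_eventually_ne_zero.resolve_left fun h => ?_
    rw [← analyticOrderAt_eq_top, ho] at h
    exact ENat.natCast_ne_top _ h
  have hfac : ∀ᶠ z in 𝓝[≠] z₀, deriv Fl (R z) = w z ^ (a * q - q * b) * Φ z := by
    filter_upwards [hder, hw0] with z h1 h2
    rw [← h1, mul_inv_cancel_left₀ (pow_ne_zero _ h2)]
  -- The identity theorem carries the equality over the puncture, where the quotient itself has no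
  -- meaning.
  have hfac' : deriv Fl ∘ R =ᶠ[𝓝 z₀] w ^ (a * q - q * b) * Φ :=
    (((hFl.deriv.comp hR).frequently_eq_iff_eventually_eq ((hw.pow _).mul hΦ)).1 hfac.frequently)
  have hord : ((a * q - q * b) * o : ℕ) ≤ ν * e := by
    have h1 := analyticOrderAt_congr hfac'
    rw [hFl.deriv.analyticOrderAt_comp hR, hdord, hRe, analyticOrderAt_mul (hw.pow _) hΦ,
      analyticOrderAt_pow hw, ho, nsmul_eq_mul] at h1
    have h2 : (((a * q - q * b : ℕ) : ℕ∞) * o) ≤ ν * e := h1 ▸ le_self_add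
    exact_mod_cast h2
  rw [hμ]
  suffices h : a ≤ (ν + 1) * b by exact_mod_cast h
  have hqb : q * b ≤ a * q := by rw [mul_comm a]; exact Nat.mul_le_mul_left _ hba
  zify [hqb] at hord hrel ⊢
  have ha' : (0 : ℤ) ≤ a := by positivity
  have he' : (0 : ℤ) < e := by exact_mod_cast he
  have h1 := mul_le_mul_of_nonneg_left hord ha'
  have h2 : (a : ℤ) * ((a * q - q * b) * o) = (ν + 1) * e * (a - b) := by rw [hrel]; ring
  rw [h2] at h1
  refine le_of_mul_le_mul_left ?_ he'
  nlinarith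

end Orders

/-! ### Isolated zeros and gluing on Riemann surfaces. -/

section RiemannSurface

variable {V : Type*} [TopologicalSpace V] [ChartedSpace ℂ V]

theorem tendsto_chartAt_punctured (v₀ : V) :
    Tendsto (chartAt ℂ v₀) (𝓝[≠] v₀) (𝓝[≠] (chartAt ℂ v₀ v₀)) := by
  refine tendsto_nhdsWithin_iff.2
    ⟨((chartAt ℂ v₀).continuousAt (mem_chart_source ℂ v₀)).tendsto.mono_left nhdsWithin_le_nhds, ?_⟩
  filter_upwards [nhdsWithin_le_nhds (chart_source_mem_nhds ℂ v₀), self_mem_nhdsWithin]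
    with v hv hne h
  exact hne ((chartAt ℂ v₀).injOn hv (mem_chart_source ℂ v₀) h)

theorem tendsto_chartAt_symm (v₀ : V) :
    Tendsto (chartAt ℂ v₀).symm (𝓝 (chartAt ℂ v₀ v₀)) (𝓝 v₀) := by
  have h := ((chartAt ℂ v₀).continuousAt_symm (mem_chart_target ℂ v₀)).tendsto
  rwa [(chartAt ℂ v₀).left_inv (mem_chart_source ℂ v₀)] at h

theorem tendsto_chartAt_symm_punctured (v₀ : V) :
    Tendsto (chartAt ℂ v₀).symm (𝓝[≠] (chartAt ℂ v₀ v₀)) (𝓝[≠] v₀) := by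
  refine tendsto_nhdsWithin_iff.2
    ⟨(tendsto_chartAt_symm v₀).mono_left nhdsWithin_le_nhds, ?_⟩
  filter_upwards [nhdsWithin_le_nhds (chart_target_mem_nhds ℂ v₀), self_mem_nhdsWithin]
    with z hz hne h
  have h : (chartAt ℂ v₀).symm z = v₀ := h
  exact hne (((chartAt ℂ v₀).right_inv hz).symm.trans (congrArg _ h))

theorem nhdsNE_neBot_of_chartedSpace (v₀ : V) : (𝓝[≠] v₀).NeBot :=
  (tendsto_chartAt_symm_punctured v₀).neBot

variable [IsManifold 𝓘(ℂ) ω V]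

theorem analyticAt_comp_chartAt_symm {E : Type*} [NormedAddCommGroup E] [NormedSpace ℂ E]
    {a : V → E} {v₀ : V} (ha : ContMDiffAt 𝓘(ℂ) 𝓘(ℂ, E) ω a v₀) :
    AnalyticAt ℂ (fun z => a ((chartAt ℂ v₀).symm z)) (chartAt ℂ v₀ v₀) := by
  have h1 : ContMDiffAt 𝓘(ℂ) 𝓘(ℂ) ω (chartAt ℂ v₀).symm (chartAt ℂ v₀ v₀) :=
    contMDiffAt_symm_of_mem_maximalAtlas (IsManifold.chart_mem_maximalAtlas v₀)
      (mem_chart_target ℂ v₀)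
  have h2 : ContMDiffAt 𝓘(ℂ) 𝓘(ℂ, E) ω a ((chartAt ℂ v₀).symm (chartAt ℂ v₀ v₀)) := by
    rwa [(chartAt ℂ v₀).left_inv (mem_chart_source ℂ v₀)]
  exact (ContMDiffAt.comp _ h2 h1).contDiffAt.analyticAt

theorem contMDiffAt_comp_chartAt {Q : ℂ → ℂ} {v₀ : V} (hQ : AnalyticAt ℂ Q (chartAt ℂ v₀ v₀)) :
    ContMDiffAt 𝓘(ℂ) 𝓘(ℂ) ω (fun v => Q (chartAt ℂ v₀ v)) v₀ :=
  ContMDiffAt.comp v₀ hQ.contDiffAt.contMDiffAt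
    (contMDiffAt_of_mem_maximalAtlas (IsManifold.chart_mem_maximalAtlas v₀)
      (mem_chart_source ℂ v₀))

theorem eventually_eq_or_eventually_ne_of_contMDiffAt {a : V → ℂ} {v₀ : V}
    (ha : ContMDiffAt 𝓘(ℂ) 𝓘(ℂ) ω a v₀) (c : ℂ) :
    (∀ᶠ v in 𝓝 v₀, a v = c) ∨ ∀ᶠ v in 𝓝[≠] v₀, a v ≠ c := by
  have hleft : ∀ᶠ v in 𝓝 v₀, (chartAt ℂ v₀).symm (chartAt ℂ v₀ v) = v := by
    filter_upwards [chart_source_mem_nhds ℂ v₀] with v hv using (chartAt ℂ v₀).left_inv hv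
  refine ((analyticAt_comp_chartAt_symm ha).eventually_eq_or_eventually_ne
    (analyticAt_const (v := c))).imp (fun h => ?_) fun h => ?_
  · filter_upwards [((chartAt ℂ v₀).continuousAt (mem_chart_source ℂ v₀)).eventually h, hleft]
      with v h1 h2
    rwa [h2] at h1
  · filter_upwards [(tendsto_chartAt_punctured v₀).eventually h, nhdsWithin_le_nhds hleft]
      with v h1 h2
    rwa [h2] at h1

/-- A nonconstant holomorphic function on a connected Riemann surface has discrete fibres. -/
theorem eventually_ne_of_nonconstant [PreconnectedSpace V] {a : V → ℂ}
    (ha : ContMDiff 𝓘(ℂ) 𝓘(ℂ) ω a) (hne : ∃ v v', a v ≠ a v') (v₀ : V) :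
    ∀ᶠ v in 𝓝[≠] v₀, a v ≠ a v₀ := by
  refine (eventually_eq_or_eventually_ne_of_contMDiffAt (ha v₀) (a v₀)).resolve_left fun h => ?_
  -- By isolation of zeros this set is closed as well as open, so it would be all of `V`.
  set S : Set V := {v | ∀ᶠ v' in 𝓝 v, a v' = a v₀} with hS
  have hSo : IsOpen S := isOpen_setOfPred_eventually_nhds
  have hSc : IsClosed S := by
    refine isClosed_of_closure_subset fun v hv => ?_
    refine (eventually_eq_or_eventually_ne_of_contMDiffAt (ha v) (a v₀)).resolve_right fun hn => ?_
    obtain ⟨O, hO, hOo, hvO⟩ := mem_nhds_iff.1 (eventually_nhdsWithin_iff.1 hn)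
    obtain ⟨v', hv'O, hv'S⟩ := mem_closure_iff.1 hv O hOo hvO
    have hv'S : ∀ᶠ v'' in 𝓝 v', a v'' = a v₀ := hv'S
    have := nhdsNE_neBot_of_chartedSpace v'
    have hvv' : v' = v := by
      by_contra hne'
      exact hO hv'O hne' hv'S.self_of_nhds
    subst hvv'
    obtain ⟨v'', h1, h2⟩ := (hn.and (nhdsWithin_le_nhds hv'S)).exists
    exact h1 h2
  have huniv : S = univ := IsClopen.eq_univ ⟨hSc, hSo⟩ ⟨v₀, h⟩
  obtain ⟨v, v', hvv⟩ := hne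
  have hall : ∀ v, a v = a v₀ := fun v =>
    (show ∀ᶠ v' in 𝓝 v, a v' = a v₀ from (huniv ▸ mem_univ v : v ∈ S)).self_of_nhds
  exact hvv ((hall v).trans (hall v').symm)

/-- Local holomorphic extensions across a discrete set glue. -/
theorem exists_contMDiffOn_of_local {Ψ : V → ℂ} {Z O : Set V} (hO : IsOpen O)
    (hZ : ∀ v₀ ∈ O, ∀ᶠ v in 𝓝[≠] v₀, v ∉ Z)
    (hloc : ∀ v₀ ∈ O, ∃ Q : V → ℂ, ContMDiffAt 𝓘(ℂ) 𝓘(ℂ) ω Q v₀ ∧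
      ∀ᶠ v in 𝓝 v₀, v ∉ Z → Ψ v = Q v) :
    ∃ Φ : V → ℂ, (∀ v₀ ∈ O, ContMDiffAt 𝓘(ℂ) 𝓘(ℂ) ω Φ v₀) ∧ ∀ v ∈ O, v ∉ Z → Ψ v = Φ v := by
  have hlim : ∀ v₀ ∈ O, ∀ Q : V → ℂ, ContinuousAt Q v₀ → (∀ᶠ v in 𝓝 v₀, v ∉ Z → Ψ v = Q v) →
      limUnder (𝓝[≠] v₀) Ψ = Q v₀ := by
    intro v₀ hv₀ Q hQ hev
    have := nhdsNE_neBot_of_chartedSpace v₀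
    refine Tendsto.limUnder_eq ((hQ.tendsto.mono_left nhdsWithin_le_nhds).congr' ?_)
    filter_upwards [nhdsWithin_le_nhds hev, hZ v₀ hv₀] with v h1 h2 using (h1 h2).symm
  -- The punctured limit depends on `Ψ` alone, so it agrees with every local extension and no
  -- compatibility has to be checked.
  refine ⟨fun v => limUnder (𝓝[≠] v) Ψ, ?_, ?_⟩
  · intro v₀ hv₀
    obtain ⟨Q, hQ, hev⟩ := hloc v₀ hv₀
    refine hQ.congr_of_eventuallyEq ?_
    filter_upwards [hO.mem_nhds hv₀, (contMDiffAt_iff_contMDiffAt_nhds (by simp)).1 hQ,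
        eventually_eventually_nhds.2 hev]
      with v h1 h2 h3 using hlim v h1 Q h2.continuousAt h3
  · intro v hv hvZ
    obtain ⟨Q, hQ, hev⟩ := hloc v hv
    dsimp only
    rw [hlim v hv Q hQ.continuousAt hev]
    exact hev.self_of_nhds hvZ

end RiemannSurface

/-! ### Normal crossing charts and equations at nearby points. -/

section Charts

variable {n : ℕ} {M : Type*} [TopologicalSpace M] [ChartedSpace (Fin n → ℂ) M]

theorem contMDiffAt_chart_coord {φ : OpenPartialHomeomorph M (Fin n → ℂ)}
    (hφ : φ ∈ IsManifold.maximalAtlas 𝓘(ℂ, Fin n → ℂ) ω M) {x : M} (hx : x ∈ φ.source)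
    (l : Fin n) : ContMDiffAt 𝓘(ℂ, Fin n → ℂ) 𝓘(ℂ) ω (fun z => φ z l) x := by
  have h : ContMDiffAt 𝓘(ℂ, Fin n → ℂ) 𝓘(ℂ) ω (fun u : Fin n → ℂ => u l) (φ x) :=
    (contDiff_apply ℂ ℂ l).contDiffAt.contMDiffAt
  exact h.comp x (contMDiffAt_of_mem_maximalAtlas hφ hx)

theorem contMDiffAt_prod_chart_coord {φ : OpenPartialHomeomorph M (Fin n → ℂ)}
    (hφ : φ ∈ IsManifold.maximalAtlas 𝓘(ℂ, Fin n → ℂ) ω M) {x : M} (hx : x ∈ φ.source)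
    (S : Finset (Fin n)) :
    ContMDiffAt 𝓘(ℂ, Fin n → ℂ) 𝓘(ℂ) ω (fun z => ∏ l ∈ S, φ z l) x :=
  contMDiffAt_finsetProd fun l _ => contMDiffAt_chart_coord hφ hx l

theorem IsLocalEquation.contMDiffAt {D : Set M} {x : M} {h : M → ℂ}
    (hh : IsLocalEquation n D x h) : ContMDiffAt 𝓘(ℂ, Fin n → ℂ) 𝓘(ℂ) ω h x := by
  obtain ⟨φ, S, ⟨hφ, hx, -⟩, hS⟩ := hh
  refine (contMDiffAt_prod_chart_coord hφ hx S).congr_of_eventuallyEq ?_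
  filter_upwards [φ.open_source.mem_nhds hx] with z hz using (hS z hz).1

theorem IsLocalEquation.eventually_mem_iff {D : Set M} {x : M} {h : M → ℂ}
    (hh : IsLocalEquation n D x h) : ∀ᶠ z in 𝓝 x, z ∈ D ↔ h z = 0 := by
  obtain ⟨φ, S, ⟨hφ, hx, -⟩, hS⟩ := hh
  filter_upwards [φ.open_source.mem_nhds hx] with z hz using (hS z hz).2

/-- The coordinate of an SNC chart which defines `E j` is a local equation of it. -/
theorem IsSNCChart.isLocalEquation {J : Type*} {E : J → Set M} {x : M}
    {φ : OpenPartialHomeomorph M (Fin n → ℂ)} {ℓ : Fin n → Option J} (h : IsSNCChart n E x φ ℓ)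
    {l : Fin n} {j : J} (hl : ℓ l = some j) : IsLocalEquation n (E j) x fun z => φ z l := by
  refine ⟨φ, {l}, h.1, fun z hz => ⟨by simp, ?_⟩⟩
  rw [h.2.1 z hz j]
  exact ⟨fun ⟨l', h1, h2⟩ => h.2.2 l l' j hl h1 ▸ h2, fun h0 => ⟨l, hl, h0⟩⟩

/-- A simple normal crossing divisor has local equations. -/
theorem IsSNC.exists_isLocalEquation {J : Type*} {E : J → Set M} (hE : IsSNC n E) (x : M) :
    ∃ h : M → ℂ, IsLocalEquation n (⋃ j, E j) x h := by
  classical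
  obtain ⟨φ, ℓ, hφ, hmem, -⟩ := hE x
  refine ⟨fun z => ∏ l ∈ Finset.univ.filter fun l => (ℓ l).isSome, φ z l, φ, _, hφ,
    fun z hz => ⟨rfl, ?_⟩⟩
  rw [mem_iUnion, Finset.prod_eq_zero_iff]
  constructor
  · rintro ⟨j, hj⟩
    obtain ⟨l, hl, h0⟩ := (hmem z hz j).1 hj
    exact ⟨l, by simp [hl], h0⟩
  · rintro ⟨l, hl, h0⟩
    obtain ⟨j, hj⟩ := Option.isSome_iff_exists.1 (by simpa using hl)
    exact ⟨j, (hmem z hz j).2 ⟨l, hj, h0⟩⟩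

variable [IsManifold 𝓘(ℂ, Fin n → ℂ) ω M]

/-- A chart can be recentred at any of its points, and shrunk. -/
theorem exists_recentred_chart {φ : OpenPartialHomeomorph M (Fin n → ℂ)}
    (hφ : φ ∈ IsManifold.maximalAtlas 𝓘(ℂ, Fin n → ℂ) ω M) {x : M} (hx : x ∈ φ.source)
    {O : Set M} (hO : IsOpen O) (hxO : x ∈ O) :
    ∃ φ' : OpenPartialHomeomorph M (Fin n → ℂ), IsCentredChart n x φ' ∧
      φ'.source ⊆ φ.source ∩ O ∧ ∀ z l, φ' z l = φ z l - φ x l := by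
  set τ := (Homeomorph.subRight (φ x)).toOpenPartialHomeomorph with hτ
  set φ' := (φ.trans τ).restrOpen O hO with hφ'
  have hs : φ'.source = φ.source ∩ O := by
    simp [hφ', hτ]
  have hval : ∀ z, φ' z = φ z - φ x := fun z => rfl
  refine ⟨φ', ⟨?_, ?_, ?_⟩, hs.subset, fun z l => by rw [hval]; rfl⟩
  · refine φ'.mem_maximalAtlas_of_contMDiffOn (fun z hz => ?_) (fun u hu => ?_)
    · refine ContMDiffAt.contMDiffWithinAt ?_
      rw [hs] at hz
      have h1 : ContMDiffAt 𝓘(ℂ, Fin n → ℂ) 𝓘(ℂ, Fin n → ℂ) ω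
          (fun u : Fin n → ℂ => u - φ x) (φ z) :=
        (contDiff_id.sub contDiff_const).contDiffAt.contMDiffAt
      exact h1.comp z (contMDiffAt_of_mem_maximalAtlas hφ hz.1)
    · refine ContMDiffAt.contMDiffWithinAt ?_
      have h0 : u + φ x ∈ φ.target := by
        have h1 := φ'.map_target hu
        rw [hs] at h1
        have h2 : φ (φ'.symm u) = u + φ x := by
          rw [eq_comm, ← eq_sub_iff_add_eq, ← hval, φ'.right_inv hu]
        rw [← h2]; exact φ.map_source h1.1
      have h1 : ContMDiffAt 𝓘(ℂ, Fin n → ℂ) 𝓘(ℂ, Fin n → ℂ) ω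
          (fun u : Fin n → ℂ => u + φ x) u :=
        (contDiff_id.add contDiff_const).contDiffAt.contMDiffAt
      have h2 : ContMDiffAt 𝓘(ℂ, Fin n → ℂ) 𝓘(ℂ, Fin n → ℂ) ω φ.symm (u + φ x) :=
        contMDiffAt_symm_of_mem_maximalAtlas hφ h0
      have h3 := ContMDiffAt.comp (f := fun u : Fin n → ℂ => u + φ x) u h2 h1
      exact h3
  · rw [hs]; exact ⟨hx, hxO⟩
  · rw [hval, sub_self]

/-- A local equation at `x` is, at the points near `x`, a local equation up to a unit. -/
theorem IsLocalEquation.eventually_exists_isLocalEquation {D : Set M} {x : M} {w : M → ℂ}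
    (hw : IsLocalEquation n D x w) :
    ∀ᶠ x' in 𝓝 x, ∃ w' v : M → ℂ, IsLocalEquation n D x' w' ∧
      ContMDiffAt 𝓘(ℂ, Fin n → ℂ) 𝓘(ℂ) ω v x' ∧ v x' ≠ 0 ∧
      ContMDiffAt 𝓘(ℂ, Fin n → ℂ) 𝓘(ℂ) ω w x' ∧ ∀ᶠ z in 𝓝 x', w z = v z * w' z := by
  classical
  obtain ⟨φ, S, ⟨hφ, hx, -⟩, hS⟩ := hw
  filter_upwards [φ.open_source.mem_nhds hx] with x' hx'
  -- The factors that vanish at `x'` form the new equation; the product of the others is the unit.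
  set S₀ := S.filter fun l => φ x' l = 0 with hS₀
  set S₁ := S.filter fun l => ¬ φ x' l = 0 with hS₁
  have hsplit : ∀ z, ∏ l ∈ S, φ z l = (∏ l ∈ S₁, φ z l) * ∏ l ∈ S₀, φ z l := fun z => by
    rw [mul_comm, Finset.prod_filter_mul_prod_filter_not]
  have hv0 : ∏ l ∈ S₁, φ x' l ≠ 0 := Finset.prod_ne_zero_iff.2 fun l hl => by
    simpa using (Finset.mem_filter.1 hl).2
  have hv := contMDiffAt_prod_chart_coord hφ hx' S₁
  have hne : ∀ᶠ z in 𝓝 x', ∏ l ∈ S₁, φ z l ≠ 0 := hv.continuousAt.eventually_ne hv0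
  obtain ⟨O, hO, hOo, hxO⟩ := mem_nhds_iff.1 hne
  obtain ⟨φ', hc, hsrc, hval⟩ := exists_recentred_chart hφ hx' hOo hxO
  have heq : ∀ z ∈ φ.source, w z = (∏ l ∈ S₁, φ z l) * ∏ l ∈ S₀, φ z l := fun z hz => by
    rw [(hS z hz).1, hsplit]
  refine ⟨fun z => ∏ l ∈ S₀, φ z l, fun z => ∏ l ∈ S₁, φ z l, ⟨φ', S₀, hc, fun z hz => ⟨?_, ?_⟩⟩,
    hv, hv0, ?_, ?_⟩
  · refine Finset.prod_congr rfl fun l hl => ?_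
    rw [hval, (Finset.mem_filter.1 hl).2, sub_zero]
  · have h1 := hsrc hz
    have h2 : ∏ l ∈ S₁, φ z l ≠ 0 := hO h1.2
    rw [(hS z h1.1).2, heq z h1.1, mul_eq_zero, or_iff_right h2]
  · refine (contMDiffAt_prod_chart_coord hφ hx' S).congr_of_eventuallyEq ?_
    filter_upwards [φ.open_source.mem_nhds hx'] with z hz using (hS z hz).1
  · filter_upwards [φ.open_source.mem_nhds hx'] with z hz using heq z hz

/-- An SNC chart induces SNC charts at its points. -/
theorem IsSNCChart.exists_recentred {J : Type*} {E : J → Set M} {x : M}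
    {φ : OpenPartialHomeomorph M (Fin n → ℂ)} {ℓ : Fin n → Option J} (h : IsSNCChart n E x φ ℓ)
    {x' : M} (hx' : x' ∈ φ.source) :
    ∃ (φ' : OpenPartialHomeomorph M (Fin n → ℂ)) (ℓ' : Fin n → Option J),
      IsSNCChart n E x' φ' ℓ' ∧ (∀ z l, φ' z l = φ z l - φ x' l) ∧
      ∀ l, (φ x' l = 0 → ℓ' l = ℓ l) ∧ (φ x' l ≠ 0 → ℓ' l = none) := by
  classical
  have hne : ∀ᶠ z in 𝓝 x', ∀ l, φ x' l ≠ 0 → φ z l ≠ 0 := eventually_all.2 fun l => by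
    by_cases h0 : φ x' l = 0
    · exact Eventually.of_forall fun z h => absurd h0 h
    · filter_upwards [(contMDiffAt_chart_coord h.1.1 hx' l).continuousAt.eventually_ne h0]
        with z hz _ using hz
  obtain ⟨O, hO, hOo, hxO⟩ := mem_nhds_iff.1 hne
  obtain ⟨φ', hc, hsrc, hval⟩ := exists_recentred_chart h.1.1 hx' hOo hxO
  refine ⟨φ', fun l => if φ x' l = 0 then ℓ l else none, ⟨hc, ?_, ?_⟩, hval,
    fun l => ⟨fun h0 => if_pos h0, fun h0 => if_neg h0⟩⟩
  · intro z hz j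
    rw [h.2.1 z (hsrc hz).1 j]
    refine exists_congr fun l => ?_
    by_cases h0 : φ x' l = 0
    · simp [h0, hval]
    · have := hO (hsrc hz).2 l h0
      simp [h0, this]
  · intro l l' j hl hl'
    dsimp only at hl hl'
    refine h.2.2 l l' j ?_ ?_
    · by_contra hne'
      split_ifs at hl with h0
      exact hne' hl
    · by_contra hne'
      split_ifs at hl' with h0
      exact hne' hl'

end Charts

/-! ### Orbifold generators as sections near the centre of a frame. -/

section Frames

variable {n : ℕ} {X : Type*} [TopologicalSpace X] [ChartedSpace (Fin n → ℂ) X]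
  {Y : Type*} [TopologicalSpace Y] [ChartedSpace (Fin n → ℂ) Y] {I : Type*}
  {Δ : OrbifoldDivisor n X I} {π : Y → X} {p : I → ℕ}

theorem OrbifoldDivisor.mem_support_of_mem {i : I} (hi : Δ.b i < Δ.a i) {x : X}
    (hx : x ∈ Δ.comp i) : x ∈ Δ.support :=
  mem_biUnion (show i ∈ {i | Δ.b i < Δ.a i} from hi) hx

theorem IsAdaptedCovering.exists_equations (hπ : IsAdaptedCovering Δ π p) (y : Y)
    (ℓ : Fin n → Option I) : ∃ w : Fin n → Y → ℂ, ∀ l i, ℓ l = some i → Δ.b i < Δ.a i →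
      IsLocalEquation n (π ⁻¹' Δ.comp i) y (w l) := by
  suffices hw : ∀ l, ∃ w : Y → ℂ, ∀ i, ℓ l = some i → Δ.b i < Δ.a i →
      IsLocalEquation n (π ⁻¹' Δ.comp i) y w by
    choose w hw using hw
    exact ⟨w, hw⟩
  intro l
  by_cases h : ∃ i, ℓ l = some i ∧ Δ.b i < Δ.a i
  · obtain ⟨i, hi, hab⟩ := h
    obtain ⟨J, E, hE, hunion⟩ := hπ.snc i hab
    obtain ⟨w, hw⟩ := hE.exists_isLocalEquation y
    refine ⟨w, fun i' hi' _ => ?_⟩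
    obtain rfl : i = i' := Option.some.inj (hi.symm.trans hi')
    rwa [hunion]
  · exact ⟨0, fun i hi hab => absurd ⟨i, hi, hab⟩ h⟩

theorem IsAdaptedCovering.nonempty_orbifoldFrame (hπ : IsAdaptedCovering Δ π p) (y : Y) :
    Nonempty (OrbifoldFrame Δ π y) := by
  obtain ⟨φ, ℓ, hφ⟩ := Δ.snc (π y)
  obtain ⟨w, hw⟩ := hπ.exists_equations y ℓ
  exact ⟨⟨φ, ℓ, hφ, w, hw⟩⟩

namespace OrbifoldFrame

variable {y : Y}

theorem poleOrder_of_some (F : OrbifoldFrame Δ π y) {l : Fin n} {i : I} (h : F.ℓ l = some i)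
    (j : ℕ) : F.poleOrder p l j = p i - j * p i * Δ.b i / Δ.a i := by
  simp only [poleOrder, h]

theorem poleOrder_of_none (F : OrbifoldFrame Δ π y) {l : Fin n} (h : F.ℓ l = none) (j : ℕ) :
    F.poleOrder p l j = 0 := by
  simp only [poleOrder, h]

/-- When `m_i = 1` the exponent is the truncated difference `p - j p`, which is zero only thanks to
`j ≥ 1`, since `p` is unconstrained for such a component. -/
theorem poleOrder_eq_zero (F : OrbifoldFrame Δ π y) {l : Fin n}
    (h : ∀ i, F.ℓ l = some i → ¬ Δ.b i < Δ.a i) {j : ℕ} (hj : 1 ≤ j) :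
    F.poleOrder p l j = 0 := by
  rcases hl : F.ℓ l with _ | i
  · exact F.poleOrder_of_none hl j
  · have hab : Δ.b i = Δ.a i := le_antisymm (Δ.b_le_a i) (not_lt.1 (h i hl))
    rw [F.poleOrder_of_some hl, hab, Nat.mul_div_cancel _ (Δ.a_pos i)]
    exact Nat.sub_eq_zero_of_le (Nat.le_mul_of_pos_left _ hj)

/-- The pullback of a coordinate defining a component of `|Δ|` is a unit times `w_l ^ p_i`. -/
theorem exists_pullback_eq (hπ : IsAdaptedCovering Δ π p) (F : OrbifoldFrame Δ π y) {l : Fin n}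
    {i : I} (hl : F.ℓ l = some i) (hi : Δ.b i < Δ.a i) :
    ∃ u : Y → ℂ, ContMDiffAt 𝓘(ℂ, Fin n → ℂ) 𝓘(ℂ) ω u y ∧ u y ≠ 0 ∧
      ∀ᶠ y' in 𝓝 y, F.φ (π y') l = u y' * F.w l y' ^ p i :=
  hπ.pullback i hi y _ _ (F.chart.isLocalEquation hl) (F.equation l i hl hi)

theorem contMDiffAt_coord_comp (hπ : IsAdaptedCovering Δ π p) (F : OrbifoldFrame Δ π y) {z : Y}
    (hz : π z ∈ F.φ.source) (l : Fin n) :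
    ContMDiffAt 𝓘(ℂ, Fin n → ℂ) 𝓘(ℂ) ω (fun z => F.φ (π z) l) z :=
  ContMDiffAt.comp (g := fun x => F.φ x l) z (contMDiffAt_chart_coord F.chart.1.1 hz l)
    (hπ.galois.holomorphic z)

/-- The derivative of the coordinate `z_l ∘ π` along a tangent vector of `Y`. -/
def coordDeriv (F : OrbifoldFrame Δ π y) (l : Fin n) (z : Y)
    (ξ : TangentSpace 𝓘(ℂ, Fin n → ℂ) z) : ℂ :=
  mfderiv 𝓘(ℂ, Fin n → ℂ) 𝓘(ℂ) (fun z => F.φ (π z) l) z ξ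

theorem formGen_apply (F : OrbifoldFrame Δ π y) (l : Fin n) (z : Y)
    (ξ : TangentSpace 𝓘(ℂ, Fin n → ℂ) z) :
    F.formGen p l z ξ = (F.w l z ^ F.poleOrder p l 1)⁻¹ * F.coordDeriv l z ξ := rfl

variable [IsManifold 𝓘(ℂ, Fin n → ℂ) ω X] [IsManifold 𝓘(ℂ, Fin n → ℂ) ω Y]

/-- At the points near `y`, the generators of order one at `y` are multiples of those of a frame
there. -/
theorem eventually_exists_frame (hπ : IsAdaptedCovering Δ π p) (F : OrbifoldFrame Δ π y) :
    ∀ᶠ y' in 𝓝 y, ∀ l i, F.ℓ l = some i → Δ.b i < Δ.a i →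
      ∃ (F' : OrbifoldFrame Δ π y') (c : Y → ℂ), ContMDiffAt 𝓘(ℂ, Fin n → ℂ) 𝓘(ℂ) ω c y' ∧
        (∀ z, F'.φ z l = F.φ z l - F.φ (π y') l) ∧
        ∀ᶠ z in 𝓝 y', (F.w l z ^ F.poleOrder p l 1)⁻¹ =
          c z * (F'.w l z ^ F'.poleOrder p l 1)⁻¹ := by
  classical
  have hsrc : ∀ᶠ y' in 𝓝 y, π y' ∈ F.φ.source :=
    hπ.galois.holomorphic.continuous.continuousAt.preimage_mem_nhds
      (F.φ.open_source.mem_nhds F.chart.1.2.1)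
  refine eventually_all.2 fun l => ?_
  by_cases h : ∃ i, F.ℓ l = some i ∧ Δ.b i < Δ.a i
  swap
  · exact Eventually.of_forall fun y' i hi hab => absurd ⟨i, hi, hab⟩ h
  obtain ⟨i, hl, hab⟩ := h
  filter_upwards [hsrc, (F.equation l i hl hab).eventually_mem_iff,
    (F.equation l i hl hab).eventually_exists_isLocalEquation] with y' hy' hmem hex i' hi' _
  obtain rfl : i = i' := Option.some.inj (hl.symm.trans hi')
  obtain ⟨w', v, hw', hv, hv0, hw, heq⟩ := hex
  obtain ⟨φ', ℓ', hchart, hval, hℓ⟩ := F.chart.exists_recentred hy'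
  obtain ⟨W, hW⟩ := hπ.exists_equations y' ℓ'
  let F' : OrbifoldFrame Δ π y' :=
    { φ := φ', ℓ := ℓ', chart := hchart, w := Function.update W l w'
      equation := fun l' i' hi'' hab' => by
        by_cases hll : l' = l
        · subst hll
          rw [Function.update_self]
          have h1 : ℓ' l' = F.ℓ l' := by
            by_cases h0 : F.φ (π y') l' = 0
            · exact (hℓ l').1 h0
            · exact absurd (((hℓ l').2 h0).symm.trans hi'') (by simp)
          obtain rfl : i = i' := Option.some.inj (hl.symm.trans (h1.symm.trans hi''))
          exact hw'
        · rw [Function.update_of_ne hll]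
          exact hW l' i' hi'' hab' }
  have hF'w : F'.w l = w' := Function.update_self ..
  -- If the coordinate still vanishes at `π y'`, the label and pole order persist and the two
  -- equations differ by a unit. Otherwise `w_l` is invertible at `y'`, and its inverse power is
  -- itself the coefficient.
  by_cases h0 : F.φ (π y') l = 0
  · have hpole : F'.poleOrder p l 1 = F.poleOrder p l 1 := by
      rw [F'.poleOrder_of_some (((hℓ l).1 h0).trans hl), F.poleOrder_of_some hl]
    refine ⟨F', fun z => (v z ^ F.poleOrder p l 1)⁻¹, (hv.pow _).inv₀ (pow_ne_zero _ hv0),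
      fun z => hval z l, ?_⟩
    filter_upwards [heq] with z hz
    rw [hpole, hF'w, hz, mul_pow, mul_inv]
  · have hpole : F'.poleOrder p l 1 = 0 := F'.poleOrder_of_none ((hℓ l).2 h0) 1
    have hw0 : F.w l y' ≠ 0 := by
      intro hw0
      obtain ⟨l', hl', h0'⟩ := (F.chart.2.1 _ hy' i).1 (hmem.2 hw0)
      exact h0 (F.chart.2.2 l l' i hl hl' ▸ h0')
    refine ⟨F', fun z => (F.w l z ^ F.poleOrder p l 1)⁻¹, (hw.pow _).inv₀ (pow_ne_zero _ hw0),
      fun z => hval z l, Eventually.of_forall fun z => ?_⟩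
    rw [hpole, pow_zero, inv_one, mul_one]

/-- Near `y`, the generators of order one of a frame at `y` are orbifold forms and orbifold jet
differentials of every order. -/
theorem exists_isOpen_sections (hπ : IsAdaptedCovering Δ π p) (F : OrbifoldFrame Δ π y) :
    ∃ U : Set Y, IsOpen U ∧ y ∈ U ∧ ∀ l i, F.ℓ l = some i → Δ.b i < Δ.a i →
      IsOrbifoldForm Δ π p U (F.formGen p l) ∧
      ∀ k ≥ 1, IsOrbifoldJetDifferential Δ π p k U (F.jetGen p l 1) := by
  classical
  have hsrc : ∀ᶠ y' in 𝓝 y, π y' ∈ F.φ.source :=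
    hπ.galois.holomorphic.continuous.continuousAt.preimage_mem_nhds
      (F.φ.open_source.mem_nhds F.chart.1.2.1)
  obtain ⟨U, hU, hUo, hyU⟩ := mem_nhds_iff.1 ((F.eventually_exists_frame hπ).and hsrc)
  refine ⟨U, hUo, hyU, fun l i hl hab => ⟨fun y' hy' => ?_, fun k hk y' hy' => ?_⟩⟩
  · obtain ⟨F', c, hc, hval, heq⟩ := (hU hy').1 l i hl hab
    refine ⟨F', Pi.single l c, fun l' => ?_, ?_⟩
    · by_cases hll : l' = l
      · subst hll; simpa using hc
      · rw [Pi.single_eq_of_ne hll]; exact contMDiffAt_const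
    filter_upwards [heq, hUo.mem_nhds hy'] with z hz hzU _
    rw [Finset.sum_eq_single l (fun l' _ hne => by
        rw [Pi.single_eq_of_ne hne]; ext ξ; exact zero_mul (F'.formGen p l' z ξ))
      (by simp), Pi.single_eq_same]
    -- Recentring shifts the coordinate by a constant, which its differential does not see.
    have hd : HasMFDerivAt 𝓘(ℂ, Fin n → ℂ) 𝓘(ℂ) (fun z => F.φ (π z) l) z _ :=
      ((F.contMDiffAt_coord_comp hπ (hU hzU).2 l).mdifferentiableAt (by simp)).hasMFDerivAt
    have hd' := hd.sub (hasMFDerivAt_const (F.φ (π y') l) z)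
    have hfun : (fun z => F'.φ (π z) l) =
        (fun z => F.φ (π z) l) - fun _ => F.φ (π y') l := funext fun z => hval (π z)
    ext ξ
    change F.formGen p l z ξ = c z * F'.formGen p l z ξ
    have hξ : F'.coordDeriv l z ξ = F.coordDeriv l z ξ := by
      unfold coordDeriv
      rw [hfun, hd'.mfderiv]
      exact sub_zero (F.coordDeriv l z ξ)
    rw [formGen_apply, formGen_apply, hz, hξ, mul_assoc]
  · obtain ⟨F', c, hc, hval, heq⟩ := (hU hy').1 l i hl hab
    refine ⟨F', {Pi.single (l, ⟨0, hk⟩) 1}, fun _ => c, fun _ _ => hc, ?_⟩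
    filter_upwards [heq] with z hz _ γ _ _
    rw [Finset.sum_singleton, Finset.prod_eq_single (l, ⟨0, hk⟩)
      (fun q _ hq => by rw [Pi.single_eq_of_ne hq, pow_zero]) (by simp), Pi.single_eq_same, pow_one]
    simp only [jetGen, zero_add, iteratedDeriv_one, hval, deriv_sub_const]
    rw [hz]
    ring

end OrbifoldFrame

end Frames

/-! ### The base map of a lifting diagram. -/

section Diagrams

variable {n : ℕ} {X : Type*} {Y : Type*} [TopologicalSpace Y] [ChartedSpace (Fin n → ℂ) Y]

namespace LiftingDiagram

variable {π : Y → X} {f : ℂ → X} {r : ℝ} (𝒟 : LiftingDiagram n π f r)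

theorem eventually_ne (hr : 0 < r) (v₀ : 𝒟.V) :
    ∀ᶠ v in 𝓝[≠] v₀, (𝒟.ρ v : ℂ) ≠ 𝒟.ρ v₀ := by
  refine eventually_ne_of_nonconstant 𝒟.ρ_holomorphic ?_ v₀
  obtain ⟨v, hv⟩ := 𝒟.ρ_surjective ⟨0, Metric.mem_ball_self hr⟩
  obtain ⟨v', hv'⟩ := 𝒟.ρ_surjective ⟨((r / 2 : ℝ) : ℂ), by
    rw [mem_ball_zero_iff, Complex.norm_real, Real.norm_eq_abs, abs_of_pos (half_pos hr)]
    exact half_lt_self hr⟩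
  refine ⟨v, v', ?_⟩
  rw [hv, hv']
  exact fun h => (half_pos hr).ne (Complex.ofReal_injective
    (by simpa only [Complex.ofReal_zero] using h))

theorem eventually_ne_zero (hr : 0 < r) (v₀ : 𝒟.V) : ∀ᶠ v in 𝓝[≠] v₀, (𝒟.ρ v : ℂ) ≠ 0 := by
  refine (eventually_eq_or_eventually_ne_of_contMDiffAt
    (𝒟.ρ_holomorphic v₀) 0).resolve_left fun h => ?_
  have := nhdsNE_neBot_of_chartedSpace v₀
  obtain ⟨v, h1, h2⟩ := ((h.filter_mono nhdsWithin_le_nhds).and (𝒟.eventually_ne hr v₀)).exists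
  exact h2 (h1.trans h.self_of_nhds.symm)

/-- The map `ρ` in the preferred chart at `v₀`. -/
def chartRho (v₀ : 𝒟.V) (z : ℂ) : ℂ := 𝒟.ρ ((chartAt ℂ v₀).symm z)

theorem chartRho_self (v₀ : 𝒟.V) : 𝒟.chartRho v₀ (chartAt ℂ v₀ v₀) = 𝒟.ρ v₀ := by
  rw [chartRho, (chartAt ℂ v₀).left_inv (mem_chart_source ℂ v₀)]

theorem analyticAt_chartRho (v₀ : 𝒟.V) :
    AnalyticAt ℂ (𝒟.chartRho v₀) (chartAt ℂ v₀ v₀) :=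
  analyticAt_comp_chartAt_symm (𝒟.ρ_holomorphic v₀)

theorem order_chartRho_ne_top (hr : 0 < r) (v₀ : 𝒟.V) :
    analyticOrderAt (fun z => 𝒟.chartRho v₀ z - 𝒟.chartRho v₀ (chartAt ℂ v₀ v₀))
      (chartAt ℂ v₀ v₀) ≠ ⊤ := by
  rw [Ne, analyticOrderAt_eq_top]
  intro h
  have h1 := (tendsto_chartAt_symm_punctured v₀).eventually (𝒟.eventually_ne hr v₀)
  obtain ⟨z, h2, h3⟩ := ((h.filter_mono nhdsWithin_le_nhds).and h1).exists
  rw [𝒟.chartRho_self, sub_eq_zero] at h2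
  exact h3 h2

/-- The form `ρ^* dt` has isolated zeros. -/
theorem eventually_exists_dt_ne_zero (hr : 0 < r) (v₀ : 𝒟.V) :
    ∀ᶠ v in 𝓝[≠] v₀, ∃ ξ : TangentSpace 𝓘(ℂ) v, 𝒟.dt v ξ ≠ 0 := by
  have hR := 𝒟.analyticAt_chartRho v₀
  have hder : ∀ᶠ z in 𝓝[≠] (chartAt ℂ v₀ v₀), deriv (𝒟.chartRho v₀) z ≠ 0 := by
    refine hR.deriv.eventually_eq_zero_or_eventually_ne_zero.resolve_left fun h => ?_
    refine 𝒟.order_chartRho_ne_top hr v₀ ?_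
    rw [← hR.analyticOrderAt_deriv_add_one, analyticOrderAt_eq_top.2 h]
    rfl
  filter_upwards [(tendsto_chartAt_punctured v₀).eventually hder,
    nhdsWithin_le_nhds (chart_source_mem_nhds ℂ v₀)] with v hv hvs
  by_contra hall
  push Not at hall
  -- By the chain rule, a zero of `ρ^* dt` is a zero of the derivative of `ρ` in the chart at `v₀`.
  have hdt : 𝒟.dt v = 0 := ContinuousLinearMap.ext hall
  have h1 : HasMFDerivAt 𝓘(ℂ) 𝓘(ℂ) (fun v' => (𝒟.ρ v' : ℂ)) v (𝒟.dt v) :=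
    ((𝒟.ρ_holomorphic v).mdifferentiableAt (by simp)).hasMFDerivAt
  have hleft : (chartAt ℂ v₀).symm (chartAt ℂ v₀ v) = v := (chartAt ℂ v₀).left_inv hvs
  have h2 : MDifferentiableAt 𝓘(ℂ) 𝓘(ℂ) (chartAt ℂ v₀).symm (chartAt ℂ v₀ v) :=
    (contMDiffAt_symm_of_mem_maximalAtlas (n := ω) (IsManifold.chart_mem_maximalAtlas v₀)
      ((chartAt ℂ v₀).map_source hvs)).mdifferentiableAt (by simp)
  rw [hdt] at h1
  have h3 : HasMFDerivAt 𝓘(ℂ) 𝓘(ℂ) (fun v' => (𝒟.ρ v' : ℂ))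
      ((chartAt ℂ v₀).symm (chartAt ℂ v₀ v)) 0 := by
    rw [hleft]; exact h1
  have h4 : HasFDerivAt (𝒟.chartRho v₀) (0 : ℂ →L[ℂ] ℂ) (chartAt ℂ v₀ v) :=
    (h3.comp _ h2.hasMFDerivAt).hasFDerivAt
  exact hv h4.hasDerivAt.deriv

variable [TopologicalSpace X] [ChartedSpace (Fin n → ℂ) X] {I : Type*} {Δ : OrbifoldDivisor n X I}
  {p : I → ℕ}

theorem eventually_notMem_support (hr : 0 < r)
    (hΔ : ∀ t ∈ Metric.ball (0 : ℂ) r, t ≠ 0 → f t ∉ Δ.support) (v₀ : 𝒟.V) :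
    ∀ᶠ v in 𝓝[≠] v₀, π (𝒟.g v) ∉ Δ.support := by
  filter_upwards [𝒟.eventually_ne_zero hr v₀] with v hv
  rw [𝒟.comm]
  exact hΔ _ (𝒟.ρ v).2 hv

end LiftingDiagram

end Diagrams

/-! ### Vanishing orders of local equations along a curve. -/

section Curves

variable {n : ℕ} {X : Type*} [TopologicalSpace X] [ChartedSpace (Fin n → ℂ) X]
  {f : ℂ → X} {r : ℝ} {I : Type*} {Δ : OrbifoldDivisor n X I}

theorem analyticAt_chart_coord_comp {φ : OpenPartialHomeomorph X (Fin n → ℂ)}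
    (hφ : φ ∈ IsManifold.maximalAtlas 𝓘(ℂ, Fin n → ℂ) ω X) {t : ℂ}
    (hf : ContMDiffAt 𝓘(ℂ) 𝓘(ℂ, Fin n → ℂ) ω f t) (ht : f t ∈ φ.source) (l : Fin n) :
    AnalyticAt ℂ (fun s => φ (f s) l) t :=
  (ContMDiffAt.comp (g := fun x => φ x l) t (contMDiffAt_chart_coord hφ ht l)
    hf).contDiffAt.analyticAt

/-- The coordinate defining a component of `|Δ|` does not vanish identically along the curve. -/
theorem order_coord_ne_top {x : X} {φ : OpenPartialHomeomorph X (Fin n → ℂ)}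
    {ℓ : Fin n → Option I} (hφ : IsSNCChart n Δ.comp x φ ℓ)
    (hΔ : ∀ t ∈ Metric.ball (0 : ℂ) r, t ≠ 0 → f t ∉ Δ.support) {t : ℂ}
    (ht : t ∈ Metric.ball (0 : ℂ) r) (hf : ContMDiffAt 𝓘(ℂ) 𝓘(ℂ, Fin n → ℂ) ω f t)
    (hft : f t ∈ φ.source) {l : Fin n} {i : I} (hl : ℓ l = some i) (hi : Δ.b i < Δ.a i) :
    analyticOrderAt (fun s => φ (f s) l) t ≠ ⊤ := by
  rw [Ne, analyticOrderAt_eq_top]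
  intro h
  have hsrc : ∀ᶠ s in 𝓝 t, f s ∈ φ.source :=
    hf.continuousAt.preimage_mem_nhds (φ.open_source.mem_nhds hft)
  have h0 : ∀ᶠ s in 𝓝[≠] t, s ≠ 0 := by
    by_cases ht0 : t = 0
    · subst ht0; exact self_mem_nhdsWithin
    · exact nhdsWithin_le_nhds (isOpen_ne.mem_nhds ht0)
  obtain ⟨s, ⟨h1, h2, h3⟩, h4⟩ := (((h.and (hsrc.and
    (Metric.isOpen_ball.mem_nhds ht))).filter_mono nhdsWithin_le_nhds).and h0).exists
  exact hΔ s h3 h4 (OrbifoldDivisor.mem_support_of_mem hi ((hφ.2.1 _ h2 i).2 ⟨l, hl, h1⟩))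

/-- Clearing the denominator also covers `m_i = ∞`: then `b_i = 0` and both sides fail. Finiteness
of `N` is essential there, as `⊤ * 0 = 0`. -/
theorem OrbifoldDivisor.m_le_iff {i : I} {N : ℕ∞} (hN : N ≠ ⊤) :
    Δ.m i ≤ (N : ℝ≥0∞) ↔ (Δ.a i : ℕ∞) ≤ N * Δ.b i := by
  have hN' : (N : ℝ≥0∞) ≠ ⊤ := by simpa using hN
  rw [OrbifoldDivisor.m, ENNReal.div_le_iff_le_mul (Or.inr hN') (Or.inl (ENNReal.natCast_ne_top _)),
    ← ENat.toENNReal_coe, ← ENat.toENNReal_coe, ← ENat.toENNReal_mul, ENat.toENNReal_le]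

/-- If `A` had the smaller order `m`, dividing the bound by `‖s - t‖ ^ m` would make the leading
coefficient of `A` vanish in the limit. -/
theorem le_order_of_norm_le {A B : ℂ → ℂ} {t : ℂ} (hA : AnalyticAt ℂ A t) (hB : AnalyticAt ℂ B t)
    {K : ℝ} (h : ∀ᶠ s in 𝓝 t, ‖A s‖ ≤ K * ‖B s‖) : analyticOrderAt B t ≤ analyticOrderAt A t := by
  by_contra! hlt
  obtain ⟨m, hm⟩ := ENat.ne_top_iff_exists.1 (ne_top_of_lt hlt)
  rw [← hm] at hlt
  obtain ⟨A₁, hA₁, hA₁0, hAeq⟩ := hA.analyticOrderAt_eq_natCast.1 hm.symm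
  obtain ⟨B₁, hB₁, hBeq⟩ := (natCast_le_analyticOrderAt hB (n := m + 1)).1
    (by exact_mod_cast Order.add_one_le_of_lt hlt)
  have hlim : Tendsto (fun s => K * (‖s - t‖ * ‖B₁ s‖)) (𝓝[≠] t) (𝓝 0) := by
    have : ContinuousAt (fun s => K * (‖s - t‖ * ‖B₁ s‖)) t :=
      continuousAt_const.mul ((by fun_prop : ContinuousAt (fun s => ‖s - t‖) t).mul
        hB₁.continuousAt.norm)
    have h2 := this.tendsto.mono_left (nhdsWithin_le_nhds (s := {t}ᶜ))
    simpa using h2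
  have hA₁lim : Tendsto (fun s => ‖A₁ s‖) (𝓝[≠] t) (𝓝 ‖A₁ t‖) :=
    hA₁.continuousAt.norm.tendsto.mono_left nhdsWithin_le_nhds
  have hle : ‖A₁ t‖ ≤ 0 := by
    refine le_of_tendsto_of_tendsto hA₁lim hlim ?_
    filter_upwards [nhdsWithin_le_nhds h, nhdsWithin_le_nhds hAeq, nhdsWithin_le_nhds hBeq,
      self_mem_nhdsWithin] with s h1 h2 h3 h4
    have h5 : 0 < ‖s - t‖ ^ m := by
      have : 0 < ‖s - t‖ := norm_pos_iff.2 (sub_ne_zero.2 h4)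
      positivity
    rw [h2, h3, norm_smul, norm_smul, norm_pow, norm_pow, pow_succ] at h1
    refine le_of_mul_le_mul_left ?_ h5
    linarith
  exact hA₁0 (norm_le_zero_iff.1 hle)

/-- Any local equation of the hypersurface `(φ_l = 0)` vanishes along a curve to at least the
order of the coordinate `φ_l`. -/
theorem IsLocalEquation.order_coord_le {D : Set X} {t : ℂ} {h : X → ℂ}
    (hh : IsLocalEquation n D (f t) h) {φ : OpenPartialHomeomorph X (Fin n → ℂ)}
    (hφ : φ ∈ IsManifold.maximalAtlas 𝓘(ℂ, Fin n → ℂ) ω X) (ht : f t ∈ φ.source)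
    (hf : ContMDiffAt 𝓘(ℂ) 𝓘(ℂ, Fin n → ℂ) ω f t) {l : Fin n} (h0 : φ (f t) l = 0)
    (hD : ∀ x ∈ φ.source, φ x l = 0 → x ∈ D) :
    analyticOrderAt (fun s => φ (f s) l) t ≤ analyticOrderAt (fun s => h (f s)) t := by
  set γ : ℂ → Fin n → ℂ := fun s => φ (f s) with hγ
  -- The curve is projected onto the hyperplane `φ_l = 0`, where `h` vanishes. In the sup norm the
  -- displacement is `|φ_l (f s)|`, so a Lipschitz bound for `h` compares the two orders.
  set γ₀ : ℂ → Fin n → ℂ := fun s => Function.update (γ s) l 0 with hγ₀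
  have hγc : ContinuousAt γ t :=
    ContinuousAt.comp (g := φ) (φ.continuousAt ht) hf.continuousAt
  have hγ₀c : ContinuousAt γ₀ t := hγc.update l continuousAt_const
  have hγ₀t : γ₀ t = φ (f t) := by
    simp only [hγ₀, hγ]
    rw [← h0, Function.update_eq_self]
  have hsymm : ContMDiffAt 𝓘(ℂ, Fin n → ℂ) 𝓘(ℂ, Fin n → ℂ) ω φ.symm (φ (f t)) :=
    contMDiffAt_symm_of_mem_maximalAtlas hφ (φ.map_source ht)
  have hleft : φ.symm (φ (f t)) = f t := φ.left_inv ht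
  have hHc : ContDiffAt ℂ ω (fun u => h (φ.symm u)) (φ (f t)) := by
    have h1 : ContMDiffAt 𝓘(ℂ, Fin n → ℂ) 𝓘(ℂ) ω h (φ.symm (φ (f t))) := by
      rw [hleft]; exact hh.contMDiffAt
    exact (ContMDiffAt.comp _ h1 hsymm).contDiffAt
  obtain ⟨K, T, hT, hlip⟩ := (hHc.of_le (m := 1) (by simp)).exists_lipschitzOnWith
  refine le_order_of_norm_le (K := K) ?_ (analyticAt_chart_coord_comp hφ hf ht l) ?_
  · exact (ContMDiffAt.comp (g := h) t hh.contMDiffAt hf).contDiffAt.analyticAt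
  have hmem : ∀ᶠ x in 𝓝 (φ (f t)), φ.symm x ∈ D → h (φ.symm x) = 0 := by
    have h1 : ∀ᶠ x in 𝓝 (φ.symm (φ (f t))), x ∈ D → h x = 0 := by
      rw [hleft]; exact hh.eventually_mem_iff.mono fun x hx => hx.1
    exact hsymm.continuousAt.eventually h1
  have htgt : φ.target ∈ 𝓝 (φ (f t)) := φ.open_target.mem_nhds (φ.map_source ht)
  have e1 : ∀ᶠ s in 𝓝 t, γ s ∈ T := hγc.preimage_mem_nhds hT
  have e2 : ∀ᶠ s in 𝓝 t, γ₀ s ∈ T ∩ φ.target ∧ (φ.symm (γ₀ s) ∈ D → h (φ.symm (γ₀ s)) = 0) := by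
    have h1 := inter_mem (inter_mem hT htgt) hmem
    rw [← hγ₀t] at h1
    exact hγ₀c.preimage_mem_nhds h1
  have e3 : ∀ᶠ s in 𝓝 t, f s ∈ φ.source :=
    hf.continuousAt.preimage_mem_nhds (φ.open_source.mem_nhds ht)
  filter_upwards [e1, e2, e3] with s h1 h2 h3
  have h4 : h (φ.symm (γ₀ s)) = 0 := by
    refine h2.2 (hD _ (φ.map_target h2.1.2) ?_)
    rw [φ.right_inv h2.1.2]
    exact Function.update_self ..
  have h5 := hlip.dist_le_mul _ h1 _ h2.1.1
  rw [h4, dist_zero_right, show φ.symm (γ s) = f s from φ.left_inv h3] at h5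
  refine h5.trans (mul_le_mul_of_nonneg_left ?_ K.2)
  refine (dist_pi_le_iff (norm_nonneg _)).2 fun l' => ?_
  by_cases hll : l' = l
  · subst hll
    rw [show γ₀ s l' = 0 from Function.update_self .., dist_zero_right]
  · rw [show γ₀ s l' = γ s l' from Function.update_of_ne hll .., dist_self]
    exact norm_nonneg _

end Curves

/-! ### Orbifold forms and jets along a lift. -/

section LocalAnalysis

variable {n : ℕ} {X : Type*} [TopologicalSpace X] [ChartedSpace (Fin n → ℂ) X]
  {Y : Type*} [TopologicalSpace Y] [ChartedSpace (Fin n → ℂ) Y] {I : Type*}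
  {Δ : OrbifoldDivisor n X I} {π : Y → X} {p : I → ℕ} {f : ℂ → X} {r : ℝ}

namespace LiftingDiagram

variable (𝒟 : LiftingDiagram n π f r)

theorem mem_frame_source {v₀ : 𝒟.V} (F : OrbifoldFrame Δ π (𝒟.g v₀)) :
    f (𝒟.ρ v₀) ∈ F.φ.source := 𝒟.comm v₀ ▸ F.chart.1.2.1

theorem frame_apply_center {v₀ : 𝒟.V} (F : OrbifoldFrame Δ π (𝒟.g v₀)) :
    F.φ (f (𝒟.ρ v₀)) = 0 := 𝒟.comm v₀ ▸ F.chart.1.2.2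

theorem jetGen_liftedJet {v₀ : 𝒟.V} (F : OrbifoldFrame Δ π (𝒟.g v₀)) (l : Fin n) (j : ℕ)
    (v : 𝒟.V) :
    F.jetGen p l j (𝒟.liftedJet v).1 (𝒟.liftedJet v).2 =
      (F.w l (𝒟.g v) ^ F.poleOrder p l j)⁻¹ *
        ((j.factorial : ℂ)⁻¹ * iteratedDeriv j (fun t => F.φ (f t) l) (𝒟.ρ v)) := by
  have h := congrFun (iteratedDeriv_comp_const_add j (fun t => F.φ (f t) l) (𝒟.ρ v : ℂ)) 0
  rw [add_zero] at h
  rw [← h]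
  rfl

/-- In the preferred chart at `v₀`, the coordinate of a frame along the curve is a unit times the
`p_i`-th power of the local equation of `D_i`. -/
theorem exists_chart_factorization (hπ : IsAdaptedCovering Δ π p) {v₀ : 𝒟.V}
    (F : OrbifoldFrame Δ π (𝒟.g v₀)) {l : Fin n} {i : I} (hl : F.ℓ l = some i)
    (hi : Δ.b i < Δ.a i) :
    AnalyticAt ℂ (fun z => F.w l (𝒟.g ((chartAt ℂ v₀).symm z))) (chartAt ℂ v₀ v₀) ∧
    ∃ u : ℂ → ℂ, AnalyticAt ℂ u (chartAt ℂ v₀ v₀) ∧ u (chartAt ℂ v₀ v₀) ≠ 0 ∧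
      ∀ᶠ z in 𝓝 (chartAt ℂ v₀ v₀), F.φ (f (𝒟.chartRho v₀ z)) l =
        u z * F.w l (𝒟.g ((chartAt ℂ v₀).symm z)) ^ p i := by
  have hw := analyticAt_comp_chartAt_symm
    (ContMDiffAt.comp v₀ (F.equation l i hl hi).contMDiffAt (𝒟.g_holomorphic v₀))
  obtain ⟨u, hu, hu0, heq⟩ := F.exists_pullback_eq hπ hl hi
  have hu' := analyticAt_comp_chartAt_symm (ContMDiffAt.comp v₀ hu (𝒟.g_holomorphic v₀))
  refine ⟨hw, _, hu', ?_, ?_⟩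
  · rw [(chartAt ℂ v₀).left_inv (mem_chart_source ℂ v₀)]
    exact hu0
  · have hlim : Tendsto (fun z => 𝒟.g ((chartAt ℂ v₀).symm z)) (𝓝 (chartAt ℂ v₀ v₀))
        (𝓝 (𝒟.g v₀)) :=
      (𝒟.g_holomorphic v₀).continuousAt.tendsto.comp (tendsto_chartAt_symm v₀)
    filter_upwards [hlim.eventually heq] with z hz
    rw [𝒟.comm] at hz
    exact hz

theorem order_mul_of_isOrbifoldCurve (horb : Δ.IsOrbifoldCurve f r) {v₀ : 𝒟.V}
    (F : OrbifoldFrame Δ π (𝒟.g v₀)) {l : Fin n} {i : I} (hl : F.ℓ l = some i)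
    (hord : analyticOrderAt (fun t => F.φ (f t) l) (𝒟.ρ v₀) ≠ ⊤) :
    (Δ.a i : ℕ∞) ≤ analyticOrderAt (fun t => F.φ (f t) l) (𝒟.ρ v₀) * Δ.b i := by
  rw [← OrbifoldDivisor.m_le_iff hord]
  refine horb.2 _ (𝒟.ρ v₀).2 i ?_ (fun x => F.φ x l) (𝒟.comm v₀ ▸ F.chart.isLocalEquation hl)
  exact (F.chart.2.1 _ (𝒟.mem_frame_source F) i).2 ⟨l, hl, by rw [𝒟.frame_apply_center]; rfl⟩

/-- Along an orbifold curve the generators of the orbifold jet differentials are holomorphic. -/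
theorem exists_extension_jetGen (hπ : IsAdaptedCovering Δ π p) (hr : 0 < r)
    (hf : ∀ t ∈ Metric.ball (0 : ℂ) r, ContMDiffAt 𝓘(ℂ) 𝓘(ℂ, Fin n → ℂ) ω f t)
    (hΔ : ∀ t ∈ Metric.ball (0 : ℂ) r, t ≠ 0 → f t ∉ Δ.support)
    (horb : Δ.IsOrbifoldCurve f r) {v₀ : 𝒟.V} (F : OrbifoldFrame Δ π (𝒟.g v₀)) (l : Fin n)
    {j : ℕ} (hj : 1 ≤ j) :
    ∃ Q : 𝒟.V → ℂ, ContMDiffAt 𝓘(ℂ) 𝓘(ℂ) ω Q v₀ ∧ ∀ᶠ v in 𝓝 v₀, π (𝒟.g v) ∉ Δ.support →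
      F.jetGen p l j (𝒟.liftedJet v).1 (𝒟.liftedJet v).2 = Q v := by
  have hFl := analyticAt_chart_coord_comp F.chart.1.1 (hf _ (𝒟.ρ v₀).2) (𝒟.mem_frame_source F) l
  by_cases h : ∃ i, F.ℓ l = some i ∧ Δ.b i < Δ.a i
  · obtain ⟨i, hl, hi⟩ := h
    have hord := order_coord_ne_top F.chart hΔ (𝒟.ρ v₀).2 (hf _ (𝒟.ρ v₀).2)
      (𝒟.mem_frame_source F) hl hi
    have hab := 𝒟.order_mul_of_isOrbifoldCurve horb F hl hord
    obtain ⟨hw, u, hu, hu0, heq⟩ := 𝒟.exists_chart_factorization hπ F hl hi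
    rw [← 𝒟.chartRho_self] at hFl hord hab
    obtain ⟨Q, hQ, hQeq⟩ := exists_analyticAt_jet_quotient (hπ.dvd i hi) (Δ.a_pos i)
      (𝒟.analyticAt_chartRho v₀) (𝒟.order_chartRho_ne_top hr v₀) hFl hord hw hu hu0 heq hab j
    refine ⟨fun v => (j.factorial : ℂ)⁻¹ * Q (chartAt ℂ v₀ v),
      contMDiffAt_comp_chartAt (Q := fun z => (j.factorial : ℂ)⁻¹ * Q z)
        (analyticAt_const.mul hQ), ?_⟩
    have h1 := eventually_nhdsWithin_iff.1 ((tendsto_chartAt_punctured v₀).eventually hQeq)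
    filter_upwards [h1, chart_source_mem_nhds ℂ v₀] with v hv hvs hvΔ
    -- The centre lies over `Δ_i`, so the conventional value of the inverse of `w_l = 0` there is
    -- never tested.
    have hne : v ≠ v₀ := by
      rintro rfl
      refine hvΔ (OrbifoldDivisor.mem_support_of_mem hi ?_)
      exact (F.chart.2.1 _ F.chart.1.2.1 i).2 ⟨l, hl, by rw [F.chart.1.2.2]; rfl⟩
    have h2 := hv hne
    rw [chartRho, (chartAt ℂ v₀).left_inv hvs] at h2
    rw [𝒟.jetGen_liftedJet, F.poleOrder_of_some hl, ← h2]
    ring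
  · have hpole : F.poleOrder p l j = 0 :=
      F.poleOrder_eq_zero (fun i hl hi => h ⟨i, hl, hi⟩) hj
    have hD : AnalyticAt ℂ (iteratedDeriv j fun t => F.φ (f t) l) (𝒟.ρ v₀) := by
      rw [iteratedDeriv_eq_iterate]; exact hFl.iterated_deriv j
    refine ⟨fun v => (j.factorial : ℂ)⁻¹ * iteratedDeriv j (fun t => F.φ (f t) l) (𝒟.ρ v),
      ContMDiffAt.comp (g := fun t => (j.factorial : ℂ)⁻¹ * iteratedDeriv j
        (fun t => F.φ (f t) l) t) v₀ (analyticAt_const.mul hD).contDiffAt.contMDiffAt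
        (𝒟.ρ_holomorphic v₀), Eventually.of_forall fun v _ => ?_⟩
    rw [𝒟.jetGen_liftedJet, hpole, pow_zero, inv_one, one_mul]

/-- The generator of order one of the orbifold jet differentials is the quotient of the
corresponding orbifold form by `ρ^* dt`. -/
theorem eventually_formGen_eq (hπ : IsAdaptedCovering Δ π p)
    (hf : ∀ t ∈ Metric.ball (0 : ℂ) r, ContMDiffAt 𝓘(ℂ) 𝓘(ℂ, Fin n → ℂ) ω f t)
    {v₀ : 𝒟.V} (F : OrbifoldFrame Δ π (𝒟.g v₀)) (l : Fin n) :
    ∀ᶠ v in 𝓝 v₀, ∀ ξ : TangentSpace 𝓘(ℂ) v,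
      F.formGen p l (𝒟.g v) (mfderiv 𝓘(ℂ) 𝓘(ℂ, Fin n → ℂ) 𝒟.g v ξ) =
        F.jetGen p l 1 (𝒟.liftedJet v).1 (𝒟.liftedJet v).2 * 𝒟.dt v ξ := by
  have hsrc : ∀ᶠ v in 𝓝 v₀, π (𝒟.g v) ∈ F.φ.source :=
    ((hπ.galois.holomorphic (𝒟.g v₀)).continuousAt.comp
      (𝒟.g_holomorphic v₀).continuousAt).preimage_mem_nhds
      (F.φ.open_source.mem_nhds F.chart.1.2.1)
  filter_upwards [hsrc] with v hv ξ
  have hFl : DifferentiableAt ℂ (fun t => F.φ (f t) l) (𝒟.ρ v) :=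
    (analyticAt_chart_coord_comp F.chart.1.1 (hf _ (𝒟.ρ v).2) (𝒟.comm v ▸ hv) l).differentiableAt
  have h1 := mfderiv_comp_apply (I := 𝓘(ℂ)) (I' := 𝓘(ℂ, Fin n → ℂ)) (I'' := 𝓘(ℂ)) v
    (g := fun z => F.φ (π z) l) (f := 𝒟.g)
    ((F.contMDiffAt_coord_comp hπ hv l).mdifferentiableAt (by simp))
    ((𝒟.g_holomorphic v).mdifferentiableAt (by simp)) ξ
  have h2 := mfderiv_comp_apply (I := 𝓘(ℂ)) (I' := 𝓘(ℂ)) (I'' := 𝓘(ℂ)) v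
    (g := fun t => F.φ (f t) l) (f := fun v' => (𝒟.ρ v' : ℂ))
    hFl.mdifferentiableAt ((𝒟.ρ_holomorphic v).mdifferentiableAt (by simp)) ξ
  -- The one function on `V` is differentiated through `Y` and through the disc.
  have hfun : (fun z => F.φ (π z) l) ∘ 𝒟.g = (fun t => F.φ (f t) l) ∘ fun v' => (𝒟.ρ v' : ℂ) :=
    funext fun v' => by simp only [Function.comp_apply, 𝒟.comm]
  rw [hfun] at h1
  have h3 : F.coordDeriv l (𝒟.g v) (mfderiv 𝓘(ℂ) 𝓘(ℂ, Fin n → ℂ) 𝒟.g v ξ) =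
      fderiv ℂ (fun t => F.φ (f t) l) (𝒟.ρ v) (𝒟.dt v ξ) := by
    rw [← mfderiv_eq_fderiv]
    exact h1.symm.trans h2
  rw [F.formGen_apply, h3, fderiv_eq_smul_deriv, 𝒟.jetGen_liftedJet, iteratedDeriv_one,
    Nat.factorial_one, Nat.cast_one, inv_one, one_mul, smul_eq_mul]
  ring

theorem formsHolomorphic_of_isOrbifoldCurve (hπ : IsAdaptedCovering Δ π p) (hr : 0 < r)
    (hf : ∀ t ∈ Metric.ball (0 : ℂ) r, ContMDiffAt 𝓘(ℂ) 𝓘(ℂ, Fin n → ℂ) ω f t)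
    (hΔ : ∀ t ∈ Metric.ball (0 : ℂ) r, t ≠ 0 → f t ∉ Δ.support)
    (horb : Δ.IsOrbifoldCurve f r) : 𝒟.FormsHolomorphic Δ p := by
  classical
  intro U η hU hgU hη
  have hloc : ∀ v₀ : 𝒟.V, ∃ Q : 𝒟.V → ℂ, ContMDiffAt 𝓘(ℂ) 𝓘(ℂ) ω Q v₀ ∧
      ∀ᶠ v in 𝓝 v₀, π (𝒟.g v) ∉ Δ.support → ∀ ξ : TangentSpace 𝓘(ℂ) v,
        η (𝒟.g v) (mfderiv 𝓘(ℂ) 𝓘(ℂ, Fin n → ℂ) 𝒟.g v ξ) = Q v * 𝒟.dt v ξ := by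
    intro v₀
    obtain ⟨F, c, hc, heq⟩ := hη (𝒟.g v₀) (hgU (mem_range_self v₀))
    choose Q hQ hQeq using fun l =>
      𝒟.exists_extension_jetGen hπ hr hf hΔ horb F l (j := 1) le_rfl
    refine ⟨fun v => ∑ l, c l (𝒟.g v) * Q l v, ?_, ?_⟩
    · exact contMDiffAt_finsetSum fun l _ =>
        (ContMDiffAt.comp v₀ (hc l) (𝒟.g_holomorphic v₀)).mul (hQ l)
    · filter_upwards [(𝒟.g_holomorphic v₀).continuousAt.eventually heq, eventually_all.2 hQeq,
        eventually_all.2 fun l => 𝒟.eventually_formGen_eq (p := p) hπ hf F l] with v h1 h2 h3 hv ξ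
      rw [h1 hv, Finset.sum_mul, _root_.sum_apply]
      refine Finset.sum_congr rfl fun l _ => ?_
      have h4 := h3 l ξ
      rw [h2 l hv] at h4
      rw [mul_assoc, ← h4]
      rfl
  have hex : ∀ v : 𝒟.V, ∃ q : ℂ, π (𝒟.g v) ∉ Δ.support → ∀ ξ : TangentSpace 𝓘(ℂ) v,
      η (𝒟.g v) (mfderiv 𝓘(ℂ) 𝓘(ℂ, Fin n → ℂ) 𝒟.g v ξ) = q * 𝒟.dt v ξ := fun v => by
    obtain ⟨Q, -, hQ⟩ := hloc v
    exact ⟨Q v, hQ.self_of_nhds⟩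
  choose Ψ hΨ using hex
  -- The quotient is undetermined over `|Δ|` and where `ρ^* dt = 0`, both discrete. At points of the
  -- second kind off `|Δ|`, the pulled back form vanishes too, being a multiple of `ρ^* dt`, so the
  -- required equation holds for any `Φ`.
  set Z : Set 𝒟.V := {v | π (𝒟.g v) ∉ Δ.support → ∀ ξ : TangentSpace 𝓘(ℂ) v, 𝒟.dt v ξ = 0}
    with hZ
  obtain ⟨Φ, hΦ, hΦeq⟩ := exists_contMDiffOn_of_local (Ψ := Ψ) (Z := Z) isOpen_univ
    (fun v₀ _ => by
      filter_upwards [𝒟.eventually_notMem_support hr hΔ v₀, 𝒟.eventually_exists_dt_ne_zero hr v₀]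
        with v h1 h2 h3
      obtain ⟨ξ, hξ⟩ := h2
      exact hξ (h3 h1 ξ))
    (fun v₀ _ => by
      obtain ⟨Q, hQ, hQeq⟩ := hloc v₀
      refine ⟨Q, hQ, ?_⟩
      filter_upwards [hQeq] with v h1 h2
      simp only [hZ, mem_ofPred_eq, not_forall] at h2
      obtain ⟨h3, ξ, hξ⟩ := h2
      exact mul_right_cancel₀ hξ ((hΨ v h3 ξ).symm.trans (h1 h3 ξ)))
  refine ⟨Φ, fun v => hΦ v (mem_univ v), fun v hv ξ => ?_⟩
  by_cases hvZ : v ∈ Z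
  · rw [hΨ v hv ξ, hvZ hv ξ, mul_zero, mul_zero]
  · rw [hΨ v hv ξ, hΦeq v (mem_univ v) hvZ]

theorem jetInOrbifoldJetSpace_of_isOrbifoldCurve (hπ : IsAdaptedCovering Δ π p) (hr : 0 < r)
    (hf : ∀ t ∈ Metric.ball (0 : ℂ) r, ContMDiffAt 𝓘(ℂ) 𝓘(ℂ, Fin n → ℂ) ω f t)
    (hΔ : ∀ t ∈ Metric.ball (0 : ℂ) r, t ≠ 0 → f t ∉ Δ.support)
    (horb : Δ.IsOrbifoldCurve f r) (k : ℕ) : 𝒟.JetInOrbifoldJetSpace Δ p k := by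
  intro U P hU hP
  obtain ⟨Φ, hΦ, hΦeq⟩ := exists_contMDiffOn_of_local
    (Ψ := fun v => P (𝒟.liftedJet v).1 (𝒟.liftedJet v).2)
    (Z := {v | π (𝒟.g v) ∈ Δ.support}) (O := 𝒟.g ⁻¹' U)
    (hU.preimage 𝒟.g_holomorphic.continuous)
    (fun v₀ _ => 𝒟.eventually_notMem_support hr hΔ v₀)
    (fun v₀ hv₀ => by
      obtain ⟨F, s, c, hc, heq⟩ := hP (𝒟.g v₀) hv₀
      choose Q hQ hQeq using fun q : Fin n × Fin k =>
        𝒟.exists_extension_jetGen hπ hr hf hΔ horb F q.1 (j := q.2.val + 1) (by omega)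
      refine ⟨fun v => ∑ α ∈ s, c α (𝒟.g v) * ∏ q, Q q v ^ α q, ?_, ?_⟩
      · exact contMDiffAt_finsetSum fun α hα =>
          (ContMDiffAt.comp v₀ (hc α hα) (𝒟.g_holomorphic v₀)).mul
            (contMDiffAt_finsetProd fun q _ => (hQ q).pow _)
      · filter_upwards [(𝒟.g_holomorphic v₀).continuousAt.eventually heq,
          eventually_all.2 hQeq] with v h1 h2 hv
        have hγ : ContMDiffAt 𝓘(ℂ) 𝓘(ℂ, Fin n → ℂ) ω (𝒟.liftedJet v).2 0 := by
          have h3 : ContMDiffAt 𝓘(ℂ) 𝓘(ℂ, Fin n → ℂ) ω f ((𝒟.ρ v : ℂ) + 0) := by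
            rw [add_zero]; exact hf _ (𝒟.ρ v).2
          exact ContMDiffAt.comp (f := fun s : ℂ => (𝒟.ρ v : ℂ) + s) 0 h3
            (contDiff_const.add contDiff_id).contDiffAt.contMDiffAt
        have hγ0 : (𝒟.liftedJet v).2 0 = π (𝒟.g v) := by
          change f ((𝒟.ρ v : ℂ) + 0) = _
          rw [add_zero, 𝒟.comm]
        refine (h1 hv _ hγ hγ0).trans ?_
        refine Finset.sum_congr rfl fun α _ => ?_
        congr 1
        refine Finset.prod_congr rfl fun q _ => ?_
        rw [← h2 q hv]
        rfl)
  exact ⟨Φ, fun v hv => (hΦ v hv).contMDiffWithinAt, fun v hv hvΔ => hΦeq v hv hvΔ⟩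

/-- If the generator of order one is holomorphic along the lifted curve, then the curve satisfies
the multiplicity condition. -/
theorem order_mul_of_jetGen_eq (hπ : IsAdaptedCovering Δ π p) (hr : 0 < r)
    (hf : ∀ t ∈ Metric.ball (0 : ℂ) r, ContMDiffAt 𝓘(ℂ) 𝓘(ℂ, Fin n → ℂ) ω f t)
    (hΔ : ∀ t ∈ Metric.ball (0 : ℂ) r, t ≠ 0 → f t ∉ Δ.support)
    {v₀ : 𝒟.V} (F : OrbifoldFrame Δ π (𝒟.g v₀)) {l : Fin n} {i : I} (hl : F.ℓ l = some i)
    (hi : Δ.b i < Δ.a i) {Φ : 𝒟.V → ℂ} (hΦ : ContMDiffAt 𝓘(ℂ) 𝓘(ℂ) ω Φ v₀)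
    (heqΦ : ∀ᶠ v in 𝓝[≠] v₀, F.jetGen p l 1 (𝒟.liftedJet v).1 (𝒟.liftedJet v).2 = Φ v) :
    (Δ.a i : ℕ∞) ≤ analyticOrderAt (fun t => F.φ (f t) l) (𝒟.ρ v₀) * Δ.b i := by
  have hFl := analyticAt_chart_coord_comp F.chart.1.1 (hf _ (𝒟.ρ v₀).2) (𝒟.mem_frame_source F) l
  have hord := order_coord_ne_top F.chart hΔ (𝒟.ρ v₀).2 (hf _ (𝒟.ρ v₀).2)
    (𝒟.mem_frame_source F) hl hi
  have h0 : F.φ (f (𝒟.ρ v₀)) l = 0 := by rw [𝒟.frame_apply_center]; rfl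
  obtain ⟨hw, u, hu, hu0, heq⟩ := 𝒟.exists_chart_factorization hπ F hl hi
  rw [← 𝒟.chartRho_self] at hFl hord h0 ⊢
  refine le_order_mul_of_deriv_eq (hπ.pos i hi) (hπ.dvd i hi) (Δ.a_pos i) hi.le
    (𝒟.analyticAt_chartRho v₀) (𝒟.order_chartRho_ne_top hr v₀) hFl hord h0 hw hu hu0 heq
    (analyticAt_comp_chartAt_symm hΦ) ?_
  filter_upwards [(tendsto_chartAt_symm_punctured v₀).eventually heqΦ] with z hz
  rw [𝒟.jetGen_liftedJet, F.poleOrder_of_some hl, iteratedDeriv_one, Nat.factorial_one,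
    Nat.cast_one, inv_one, one_mul, one_mul] at hz
  exact hz

end LiftingDiagram

/-- The multiplicity condition at the origin in one SNC chart characterizes orbifold curves. -/
theorem isOrbifoldCurve_of_order_mul (hr : 0 < r)
    (hf : ∀ t ∈ Metric.ball (0 : ℂ) r, ContMDiffAt 𝓘(ℂ) 𝓘(ℂ, Fin n → ℂ) ω f t)
    (hΔ : ∀ t ∈ Metric.ball (0 : ℂ) r, t ≠ 0 → f t ∉ Δ.support)
    {φ : OpenPartialHomeomorph X (Fin n → ℂ)} {ℓ : Fin n → Option I}
    (hφ : IsSNCChart n Δ.comp (f 0) φ ℓ)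
    (hord : ∀ l i, ℓ l = some i → Δ.b i < Δ.a i →
      (Δ.a i : ℕ∞) ≤ analyticOrderAt (fun t => φ (f t) l) 0 * Δ.b i) :
    Δ.IsOrbifoldCurve f r := by
  have h0r : (0 : ℂ) ∈ Metric.ball (0 : ℂ) r := Metric.mem_ball_self hr
  refine ⟨⟨((r / 2 : ℝ) : ℂ), ?_⟩, fun t ht i hti h hh => ?_⟩
  · have h1 : ((r / 2 : ℝ) : ℂ) ∈ Metric.ball (0 : ℂ) r := by
      rw [mem_ball_zero_iff, Complex.norm_real, Real.norm_eq_abs, abs_of_pos (half_pos hr)]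
      exact half_lt_self hr
    exact ⟨h1, hΔ _ h1 (Complex.ofReal_ne_zero.2 (half_pos hr).ne')⟩
  · by_cases htop : analyticOrderAt (fun s => h (f s)) t = ⊤
    · rw [htop]; exact le_top
    rw [OrbifoldDivisor.m_le_iff htop]
    by_cases hi : Δ.b i < Δ.a i
    · obtain rfl : t = 0 := by
        by_contra hne
        exact hΔ t ht hne (OrbifoldDivisor.mem_support_of_mem hi hti)
      obtain ⟨l, hl, hl0⟩ := (hφ.2.1 _ hφ.1.2.1 i).1 hti
      refine (hord l i hl hi).trans (mul_le_mul_left ?_ _)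
      exact hh.order_coord_le hφ.1.1 hφ.1.2.1 (hf 0 h0r) hl0
        fun x hx hx0 => (hφ.2.1 x hx i).2 ⟨l, hl, hx0⟩
    · rw [le_antisymm (Δ.b_le_a i) (not_lt.1 hi)]
      have hne : analyticOrderAt (fun s => h (f s)) t ≠ 0 :=
        analyticOrderAt_ne_zero.2
          ⟨(ContMDiffAt.comp (g := h) t hh.contMDiffAt (hf t ht)).contDiffAt.analyticAt,
            hh.eventually_mem_iff.self_of_nhds.1 hti⟩
      exact le_mul_of_one_le_left' (Order.one_le_iff_pos.2 (pos_iff_ne_zero.2 hne))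

end LocalAnalysis

/-! ### Small discs and the equivalence. -/

section Equivalence

variable {n : ℕ} {X : Type*} [TopologicalSpace X] [ChartedSpace (Fin n → ℂ) X]
  {Y : Type*} [TopologicalSpace Y] [ChartedSpace (Fin n → ℂ) Y] {I : Type*}
  {Δ : OrbifoldDivisor n X I} {π : Y → X} {p : I → ℕ} {f : ℂ → X} {r : ℝ}

/-- A germ of curve not contained in `|Δ|` meets `|Δ|` at most at the origin. -/
theorem OrbifoldDivisor.eventually_notMem_support
    (hf : ContMDiffAt 𝓘(ℂ) 𝓘(ℂ, Fin n → ℂ) ω f 0) (hfΔ : ∃ᶠ t in 𝓝 (0 : ℂ), f t ∉ Δ.support) :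
    ∀ᶠ t in 𝓝[≠] (0 : ℂ), f t ∉ Δ.support := by
  obtain ⟨φ, ℓ, hφ⟩ := Δ.snc (f 0)
  have hsrc : ∀ᶠ t in 𝓝 (0 : ℂ), f t ∈ φ.source :=
    hf.continuousAt.preimage_mem_nhds (φ.open_source.mem_nhds hφ.1.2.1)
  have hne : ∀ l, ∀ᶠ t in 𝓝[≠] (0 : ℂ), ∀ i, ℓ l = some i → Δ.b i < Δ.a i → φ (f t) l ≠ 0 := by
    intro l
    have han := analyticAt_chart_coord_comp hφ.1.1 hf hφ.1.2.1 l
    rcases han.eventually_eq_zero_or_eventually_ne_zero with h | h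
    · refine Eventually.of_forall fun t i hl hi => ?_
      obtain ⟨s, h1, h2, h3⟩ := (hfΔ.and_eventually (hsrc.and h)).exists
      exact absurd (mem_support_of_mem hi ((hφ.2.1 _ h2 i).2 ⟨l, hl, h3⟩)) h1
    · filter_upwards [h] with t ht i _ _ using ht
  filter_upwards [eventually_all.2 hne, hsrc.filter_mono nhdsWithin_le_nhds] with t h1 h2 h3
  obtain ⟨i, hi, hti⟩ := mem_iUnion₂.1 h3
  obtain ⟨l, hl, hl0⟩ := (hφ.2.1 _ h2 i).1 hti
  exact h1 l i hl hi hl0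

/-- For small discs, the image of any lifting diagram is contained in an open set on which the
generators of order one of a frame centred over the origin are defined. -/
theorem IsAdaptedCovering.exists_frame_range_subset [T2Space Y]
    [IsManifold 𝓘(ℂ, Fin n → ℂ) ω X] [IsManifold 𝓘(ℂ, Fin n → ℂ) ω Y]
    (hπ : IsAdaptedCovering Δ π p)
    (hf : ContinuousAt f 0) :
    ∀ᶠ r : ℝ in 𝓝[>] 0, ∀ 𝒟 : LiftingDiagram n π f r,
      ∃ (v₀ : 𝒟.V) (F : OrbifoldFrame Δ π (𝒟.g v₀)) (U : Set Y),
        (𝒟.ρ v₀ : ℂ) = 0 ∧ IsOpen U ∧ range 𝒟.g ⊆ U ∧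
        ∀ l i, F.ℓ l = some i → Δ.b i < Δ.a i →
          IsOrbifoldForm Δ π p U (F.formGen p l) ∧
          ∀ k ≥ 1, IsOrbifoldJetDifferential Δ π p k U (F.jetGen p l 1) := by
  obtain ⟨F⟩ : Nonempty (∀ y, OrbifoldFrame Δ π y) :=
    ⟨fun y => (hπ.nonempty_orbifoldFrame y).some⟩
  choose U hUo hyU hU using fun y => (F y).exists_isOpen_sections hπ
  -- `W` depends only on the fibre over `f 0`, so one radius bound serves all lifting diagrams.
  obtain ⟨W, hW, hWsub⟩ := exists_nhds_preimage_subset hπ.galois.proper.isClosedMap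
    (hπ.galois.finite_fibre (f 0)) U fun y _ => (hUo y).mem_nhds (hyU y)
  obtain ⟨ε, hε, hball⟩ := Metric.eventually_nhds_iff_ball.1 (hf.eventually_mem hW)
  filter_upwards [Ioo_mem_nhdsGT hε] with r hr 𝒟
  obtain ⟨y, -, hyU', hy⟩ := hWsub (range 𝒟.g) (range_nonempty _)
    (isPreconnected_range 𝒟.g_holomorphic.continuous) (by
      rintro _ ⟨v, rfl⟩
      rw [mem_preimage, 𝒟.comm]
      exact hball _ (Metric.ball_subset_ball hr.2.le (𝒟.ρ v).2))
  obtain ⟨v₀, hv₀⟩ := 𝒟.ρ_surjective ⟨0, Metric.mem_ball_self hr.1⟩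
  have hρ : (𝒟.ρ v₀ : ℂ) = 0 := by rw [hv₀]
  obtain rfl : 𝒟.g v₀ = y := hy _ (mem_range_self v₀) (by rw [𝒟.comm, hρ])
  exact ⟨v₀, F _, U _, hρ, hUo _, hyU', hU _⟩

namespace LiftingDiagram

variable (𝒟 : LiftingDiagram n π f r)

/-- A curve is an orbifold curve if the generators of order one at a point over the origin are
holomorphic along some lift. -/
theorem isOrbifoldCurve_of_jetGen_eq (hπ : IsAdaptedCovering Δ π p) (hr : 0 < r)
    (hf : ∀ t ∈ Metric.ball (0 : ℂ) r, ContMDiffAt 𝓘(ℂ) 𝓘(ℂ, Fin n → ℂ) ω f t)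
    (hΔ : ∀ t ∈ Metric.ball (0 : ℂ) r, t ≠ 0 → f t ∉ Δ.support)
    {v₀ : 𝒟.V} (h0 : (𝒟.ρ v₀ : ℂ) = 0) (F : OrbifoldFrame Δ π (𝒟.g v₀))
    (hgen : ∀ l i, F.ℓ l = some i → Δ.b i < Δ.a i → ∃ Φ : 𝒟.V → ℂ,
      ContMDiffAt 𝓘(ℂ) 𝓘(ℂ) ω Φ v₀ ∧
      ∀ᶠ v in 𝓝[≠] v₀, F.jetGen p l 1 (𝒟.liftedJet v).1 (𝒟.liftedJet v).2 = Φ v) :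
    Δ.IsOrbifoldCurve f r := by
  have hφ := F.chart
  rw [𝒟.comm, h0] at hφ
  refine isOrbifoldCurve_of_order_mul hr hf hΔ hφ fun l i hl hi => ?_
  obtain ⟨Φ, hΦ, heq⟩ := hgen l i hl hi
  rw [← h0]
  exact 𝒟.order_mul_of_jetGen_eq hπ hr hf hΔ F hl hi hΦ heq

end LiftingDiagram

end Equivalence

end OrbifoldCurve

end

theorem mainTheorem4 {n : ℕ}
    {X : Type*} [TopologicalSpace X] [T2Space X] [ChartedSpace (Fin n → ℂ) X]
    [IsManifold 𝓘(ℂ, Fin n → ℂ) ω X]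
    {Y : Type*} [TopologicalSpace Y] [T2Space Y] [ConnectedSpace Y] [ChartedSpace (Fin n → ℂ) Y]
    [IsManifold 𝓘(ℂ, Fin n → ℂ) ω Y]
    {I : Type*} (Δ : OrbifoldCurve.OrbifoldDivisor n X I)
    (π : Y → X) (p : I → ℕ) (hπ : OrbifoldCurve.IsAdaptedCovering Δ π p)
    (f : ℂ → X) (hf : ∀ᶠ t in 𝓝 (0 : ℂ), ContMDiffAt 𝓘(ℂ) 𝓘(ℂ, Fin n → ℂ) ω f t)
    (hfΔ : ∃ᶠ t in 𝓝 (0 : ℂ), f t ∉ Δ.support) :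
    ∀ᶠ r : ℝ in 𝓝[>] 0, List.TFAE [
      Δ.IsOrbifoldCurve f r,
      ∀ 𝒟 : OrbifoldCurve.LiftingDiagram n π f r, 𝒟.FormsHolomorphic Δ p,
      ∃ 𝒟 : OrbifoldCurve.LiftingDiagram n π f r, 𝒟.FormsHolomorphic Δ p,
      ∀ 𝒟 : OrbifoldCurve.LiftingDiagram n π f r, ∀ k ≥ 1, 𝒟.JetInOrbifoldJetSpace Δ p k,
      ∀ 𝒟 : OrbifoldCurve.LiftingDiagram n π f r, ∃ k ≥ 1, 𝒟.JetInOrbifoldJetSpace Δ p k,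
      ∃ 𝒟 : OrbifoldCurve.LiftingDiagram n π f r, ∀ k ≥ 1, 𝒟.JetInOrbifoldJetSpace Δ p k,
      ∃ 𝒟 : OrbifoldCurve.LiftingDiagram n π f r, ∃ k ≥ 1, 𝒟.JetInOrbifoldJetSpace Δ p k] := by
  obtain ⟨ε₁, hε₁, hf'⟩ := Metric.eventually_nhds_iff_ball.1 hf
  obtain ⟨ε₂, hε₂, hΔ'⟩ := Metric.eventually_nhds_iff_ball.1 (eventually_nhdsWithin_iff.1
    (OrbifoldCurve.OrbifoldDivisor.eventually_notMem_support hf.self_of_nhds hfΔ))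
  -- The disc is small enough for a lift to exist, for every lift to stay inside one frame, and for
  -- `f` to be holomorphic and to avoid `|Δ|` off the origin.
  filter_upwards [hπ.galois.eventually_nonempty_liftingDiagram hπ.nc_branch hf,
    hπ.exists_frame_range_subset hf.self_of_nhds.continuousAt,
    Ioo_mem_nhdsGT (lt_min hε₁ hε₂)] with r ⟨𝒟₀⟩ hframe ⟨hr, hrε⟩
  replace hf : ∀ t ∈ Metric.ball (0 : ℂ) r, ContMDiffAt 𝓘(ℂ) 𝓘(ℂ, Fin n → ℂ) ω f t :=
    fun t ht => hf' t (Metric.ball_subset_ball (hrε.le.trans (min_le_left _ _)) ht)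
  have hΔ : ∀ t ∈ Metric.ball (0 : ℂ) r, t ≠ 0 → f t ∉ Δ.support :=
    fun t ht => hΔ' t (Metric.ball_subset_ball (hrε.le.trans (min_le_right _ _)) ht)
  tfae_have 1 → 2 := fun h 𝒟 => 𝒟.formsHolomorphic_of_isOrbifoldCurve hπ hr hf hΔ h
  tfae_have 2 → 3 := fun h => ⟨𝒟₀, h 𝒟₀⟩
  tfae_have 3 → 1 := by
    rintro ⟨𝒟, h⟩
    obtain ⟨v₀, F, U, h0, hU, hgU, hgen⟩ := hframe 𝒟
    refine 𝒟.isOrbifoldCurve_of_jetGen_eq hπ hr hf hΔ h0 F fun l i hl hi => ?_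
    obtain ⟨Φ, hΦ, hΦeq⟩ := h U _ hU hgU (hgen l i hl hi).1
    refine ⟨Φ, hΦ v₀, ?_⟩
    filter_upwards [(𝒟.eventually_formGen_eq (p := p) hπ hf F l).filter_mono nhdsWithin_le_nhds,
      𝒟.eventually_exists_dt_ne_zero hr v₀, 𝒟.eventually_notMem_support hr hΔ v₀]
      with v h1 ⟨ξ, hξ⟩ h2
    -- Dividing by `ρ^* dt`, whose zeros are isolated, turns holomorphy of the form into that of the
    -- jet generator of order one.
    exact mul_right_cancel₀ hξ ((h1 ξ).symm.trans (hΦeq v h2 ξ))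
  tfae_have 1 → 4 := fun h 𝒟 k _ =>
    𝒟.jetInOrbifoldJetSpace_of_isOrbifoldCurve hπ hr hf hΔ h k
  tfae_have 4 → 5 := fun h 𝒟 => ⟨1, le_rfl, h 𝒟 1 le_rfl⟩
  tfae_have 4 → 6 := fun h => ⟨𝒟₀, h 𝒟₀⟩
  tfae_have 5 → 7 := fun h => ⟨𝒟₀, h 𝒟₀⟩
  tfae_have 6 → 7 := fun ⟨𝒟, h⟩ => ⟨𝒟, 1, le_rfl, h 1 le_rfl⟩
  tfae_have 7 → 1 := by
    rintro ⟨𝒟, k, hk, h⟩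
    obtain ⟨v₀, F, U, h0, hU, hgU, hgen⟩ := hframe 𝒟
    refine 𝒟.isOrbifoldCurve_of_jetGen_eq hπ hr hf hΔ h0 F fun l i hl hi => ?_
    -- Generators of order one are jet differentials of every order `k ≥ 1`, so any single `k`
    -- suffices.
    obtain ⟨Φ, hΦ, hΦeq⟩ := h U _ hU ((hgen l i hl hi).2 k hk)
    refine ⟨Φ, hΦ.contMDiffAt ((hU.preimage 𝒟.g_holomorphic.continuous).mem_nhds
      (hgU (mem_range_self v₀))), ?_⟩
    filter_upwards [𝒟.eventually_notMem_support hr hΔ v₀] with v hv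
    exact hΦeq v (hgU (mem_range_self v)) hv
  tfae_finish
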